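/- Let $n\ge 2$ be an integer, let $s>1$, $p\in(1,\infty)$, $\lambda\in[n-1,n)$ and $\delta,\tau\in(0,1)$, and suppose that \[ s<\frac{n+1-\lambda}{1-\delta},\qquad p\le\frac{s(n-1)-\lambda+1}{n-s(1-\delta)-\lambda+1}. \] Then there is an $s$-John domain $G_s\subset\mathbb{R}^n$ such that $\dim_{\mathcal M}(\partial G_s)=\lambda$ and $G_s$ does not support the fractional $(1,p)$-Poincaré inequality, that is, there is no finite constant $c$ such that \[ \int_{G_s}|u(x)-u_{G_s}|\,dx\le c\left(\int_{G_s}\int_{G_s\cap B(x,\tau\,\mathrm{dist}(x,\partial G_s))}\frac{|u(x)-u(y)|^p}{|x-y|^{n+\delta p}}\,dy\,dx\right)^{1/p} \] for all real-valued $u\in L^p(G_s)$, where $u_{G_s}$ denotes the mean value of $u$ over $G_s$. Here a bounded domain (nonempty connected open set) $G\subset\mathbb{R}^n$ is an $s$-John domain if there are a point $x_0\in G$ and a constant $c>0$ such that every $x\in G$ can be joined to $x_0$ by a rectifiable curve $\gamma:[0,l]\to G$ parametrized by arc length with $\gamma(0)=x$, $\gamma(l)=x_0$, $l\le c$ and $\mathrm{dist}(\gamma(t),\partial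 G)\ge t^s/c$ for all $t\in[0,l]$. The upper Minkowski dimension of $E\subset\mathbb{R}^n$ is \[ \dim_{\mathcal M}(E)=\sup\Big\{d\ge 0 : \limsup_{r\to0+}\frac{\big|\bigcup_{x\in E}B(x,r)\big|}{r^{n-d}}=\infty\Big\}, \] with the convention $\sup\emptyset=0$, where $|\cdot|$ is Lebesgue measure and $B(x,r)$ is the open ball of radius $r$ centered at $x$. -/

import Mathlib

open MeasureTheory Set Filter Topology
open scoped ENNReal NNReal

/-- A bounded domain (nonempty, open, connected, bounded set) `G` in `ℝⁿ` is an `s`-John domain,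
`s ≥ 1`, if there are a point `x₀ ∈ G` and a constant `c > 0` such that every `x ∈ G` can be joined
to `x₀` by a curve `γ : [0, l] → G`, parametrized by arc length, with `l ≤ c` and
`dist (γ t, ∂G) ≥ t ^ s / c` for all `t ∈ [0, l]`. -/
def IsJohnDomain {n : ℕ} (s : ℝ) (G : Set (EuclideanSpace ℝ (Fin n))) : Prop :=
  1 ≤ s ∧ IsOpen G ∧ IsConnected G ∧ Bornology.IsBounded G ∧
    ∃ x₀ ∈ G, ∃ c : ℝ, 0 < c ∧ ∀ x ∈ G,
      ∃ (l : ℝ) (γ : ℝ → EuclideanSpace ℝ (Fin n)),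
        0 ≤ l ∧ l ≤ c ∧ γ 0 = x ∧ γ l = x₀ ∧
        MapsTo γ (Icc 0 l) G ∧ HasUnitSpeedOn γ (Icc 0 l) ∧
        ∀ t ∈ Icc 0 l, t ^ s / c ≤ Metric.infDist (γ t) (frontier G)

/-- The `d`-dimensional Minkowski precontent `|E + B(0, r)| / r ^ (n - d)` (for `r > 0`). -/
noncomputable def minkowskiPrecontent {n : ℕ} (d : ℝ) (E : Set (EuclideanSpace ℝ (Fin n)))
    (r : ℝ) : ℝ≥0∞ :=
  volume (⋃ x ∈ E, Metric.ball x r) / ENNReal.ofReal (r ^ ((n : ℝ) - d))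

/-- The upper Minkowski dimension: the supremum of the `d ≥ 0` for which the upper limit of the
`d`-dimensional Minkowski precontent, as `r → 0+`, is infinite. -/
noncomputable def upperMinkowskiDim {n : ℕ} (E : Set (EuclideanSpace ℝ (Fin n))) : ℝ≥0∞ :=
  ⨆ (d : ℝ≥0) (_ : limsup (fun r : ℝ => minkowskiPrecontent (d : ℝ) E r) (𝓝[>] 0) = ⊤), (d : ℝ≥0∞)

/-- The seminorm integral
`∫_G ∫_{G ∩ B(x, τ dist(x, ∂G))} |u x - u y| ^ p / |x - y| ^ (n + δ p) dy dx` in `[0, ∞]`. -/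
noncomputable def fractionalEnergy {n : ℕ} (δ τ p : ℝ) (G : Set (EuclideanSpace ℝ (Fin n)))
    (u : EuclideanSpace ℝ (Fin n) → ℝ) : ℝ≥0∞ :=
  ∫⁻ x in G, ∫⁻ y in G ∩ Metric.ball x (τ * Metric.infDist x (frontier G)),
    ENNReal.ofReal (|u x - u y| ^ p / ‖x - y‖ ^ ((n : ℝ) + δ * p))

/-- `G` supports the fractional `(q, p)`-Poincaré inequality with parameters `δ`, `τ`: there is a
finite constant `c` such that for every `u ∈ L^p(G)`, with mean value `u_G` over `G`,
`∫_G |u - u_G| ^ q ≤ c * (fractionalEnergy δ τ p G u) ^ (q / p)`. -/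
def SupportsFractionalPoincare {n : ℕ} (δ τ q p : ℝ)
    (G : Set (EuclideanSpace ℝ (Fin n))) : Prop :=
  ∃ c : ℝ≥0, ∀ u : EuclideanSpace ℝ (Fin n) → ℝ,
    MemLp u (ENNReal.ofReal p) (volume.restrict G) →
      ∫⁻ x in G, ENNReal.ofReal (|u x - ⨍ y in G, u y| ^ q) ≤
        (c : ℝ≥0∞) * fractionalEnergy δ τ p G u ^ (q / p)

/-! ### Unit speed curves and the John condition -/

section Paths

/-! The domain is a self-similar tree of rooms and tubes. A cube of half-side `β ^ k` contains a
room, a plate through its centre orthogonal to the direction `i₀`, and `2 ^ n` child cubes of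
half-side `β ^ (k + 1)`. A tube of half-thickness `ρ k`, a multiple of `(β ^ k) ^ s`, leads in the
direction `i₀` from the plate to the centre of each child.

John condition: on a walk from a deep point towards the root, the length spent while in generation
`k` is at most a multiple of `β ^ k`, by geometric summation, and the clearance there is `ρ k`
(`TreeParams.isJohnDomain`).

Dimension: `β` is chosen with `2 ^ n * β ^ lam = 1`, so `lam < n` amounts to `β < 1 / 2`. The cubes
of generation `k` have total volume of order `(2 ^ n * β ^ n) ^ k = (β ^ k) ^ (n - lam)`, and each
contains frontier points. In the neighbourhood of radius `β ^ k`, the walls of each earlier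
generation contribute no larger order, because `n - 1 ≤ lam`; the factor `k + 1` from summing over
generations does not affect the dimension (`TreeParams.upperMinkowskiDim_frontier`).

Failure of the inequality: let `ramp β j` climb from 0 to 1 inside the tubes of generation `j`, and
add `M` of these ramps with weights `(2 ^ n * β ^ n) ^ (-j)`. Each term has integral bounded below,
and the sum vanishes on the root room, so the left-hand side grows at least like `M`. At most one
ramp varies near any given point, so the energies add up; the hypothesis on `p` says that each is
bounded, so the right-hand side is at most of order `M ^ (1 / p)`. Since `p > 1`, no constant
survives `M → ∞` (`TreeParams.not_supportsFractionalPoincare`). -/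

theorem hasUnitSpeedOn_of_edist_eq {E : Type*} [PseudoEMetricSpace E] {f : ℝ → E} {S : Set ℝ}
    (hS : S.OrdConnected)
    (h : ∀ x ∈ S, ∀ y ∈ S, x ≤ y → edist (f x) (f y) = ENNReal.ofReal (y - x)) :
    HasUnitSpeedOn f S := by
  unfold HasUnitSpeedOn
  rw [hasConstantSpeedOnWith_iff_ordered]
  intro x hx y hy hxy
  have hsub : S ∩ Icc x y = Icc x y := inter_eq_right.2 (hS.out hx hy)
  rw [hsub]
  simp only [NNReal.coe_one, one_mul]
  apply le_antisymm
  · have hid : eVariationOn (fun t : ℝ => t) (Icc x y ∩ Icc x y) ≤ ENNReal.ofReal (y - x) :=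
      (MonotoneOn.eVariationOn_eq (f := fun t : ℝ => t) (monotone_id.monotoneOn _)
        (left_mem_Icc.2 hxy) (right_mem_Icc.2 hxy)).le
    rw [inter_self] at hid
    refine le_trans ?_ hid
    unfold eVariationOn
    refine iSup_mono fun p => Finset.sum_le_sum fun i _ => ?_
    have hi := hS.out hx hy (p.2.2.2 i)
    have hi' := hS.out hx hy (p.2.2.2 (i + 1))
    have hm := p.2.2.1 (Nat.le_succ i)
    rw [edist_comm, h _ hi _ hi' hm, edist_dist, Real.dist_eq, abs_of_nonneg (sub_nonneg.2 hm)]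
  · rw [← h x hx y hy hxy]
    exact eVariationOn.edist_le f (left_mem_Icc.2 hxy) (right_mem_Icc.2 hxy)

theorem HasUnitSpeedOn.edist_le {E : Type*} [PseudoEMetricSpace E] {f : ℝ → E} {S : Set ℝ}
    (h : HasUnitSpeedOn f S) {x y : ℝ} (hx : x ∈ S) (hy : y ∈ S) (hxy : x ≤ y) :
    edist (f x) (f y) ≤ ENNReal.ofReal (y - x) := by
  have h1 := h hx hy
  simp only [NNReal.coe_one, one_mul] at h1
  rw [← h1]
  exact eVariationOn.edist_le f ⟨hx, left_mem_Icc.2 hxy⟩ ⟨hy, right_mem_Icc.2 hxy⟩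

theorem HasUnitSpeedOn.continuousOn {E : Type*} [PseudoEMetricSpace E] {f : ℝ → E} {S : Set ℝ}
    (h : HasUnitSpeedOn f S) : ContinuousOn f S := by
  have : LipschitzOnWith 1 f S := by
    intro x hx y hy
    simp only [ENNReal.coe_one, one_mul]
    rcases le_total x y with hxy | hxy
    · rw [edist_dist x y, Real.dist_eq, abs_sub_comm, abs_of_nonneg (sub_nonneg.2 hxy)]
      exact h.edist_le hx hy hxy
    · rw [edist_comm, edist_dist x y, Real.dist_eq, abs_of_nonneg (sub_nonneg.2 hxy)]
      exact h.edist_le hy hx hxy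
  exact this.continuousOn

theorem HasUnitSpeedOn.comp_sub {E : Type*} [PseudoEMetricSpace E] {f : ℝ → E} {l L : ℝ}
    (h : HasUnitSpeedOn f (Icc 0 l)) :
    HasUnitSpeedOn (fun t => f (t - L)) (Icc L (L + l)) := by
  unfold HasUnitSpeedOn
  rw [hasConstantSpeedOnWith_iff_ordered]
  intro x hx y hy hxy
  have h1 := h (x := x - L) ⟨by linarith [hx.1], by linarith [hx.2]⟩ (y := y - L)
    ⟨by linarith [hy.1], by linarith [hy.2]⟩
  have hmono : MonotoneOn (fun t : ℝ => t - L) (Icc L (L + l) ∩ Icc x y) :=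
    fun a _ b _ hab => by simpa using hab
  have h2 := eVariationOn.comp_eq_of_monotoneOn f (fun t : ℝ => t - L) hmono
  have himg : (fun t : ℝ => t - L) '' (Icc L (L + l) ∩ Icc x y)
      = Icc 0 l ∩ Icc (x - L) (y - L) := by
    ext z
    constructor
    · rintro ⟨w, ⟨⟨h1, h2⟩, h3, h4⟩, rfl⟩
      exact ⟨⟨by simpa using h1, by simp only []; linarith⟩, by simpa using h3, by simpa using h4⟩
    · rintro ⟨⟨h1, h2⟩, h3, h4⟩
      exact ⟨z + L, ⟨⟨by linarith, by linarith⟩, by linarith, by linarith⟩, by simp⟩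
  rw [himg, h1] at h2
  simpa [Function.comp_def] using h2

/-- There is a unit speed curve in `G` from `x` to `x₀`, of length at most `B - b`, that stays at
distance at least `a * (t + b) ^ s` from the complement of `G` at time `t`. -/
def JohnPath {E : Type*} [NormedAddCommGroup E] (G : Set E) (x₀ : E) (a s B : ℝ) (x : E)
    (b : ℝ) : Prop :=
  ∃ (l : ℝ) (γ : ℝ → E), 0 ≤ l ∧ l + b ≤ B ∧ γ 0 = x ∧ γ l = x₀ ∧ HasUnitSpeedOn γ (Icc 0 l) ∧
    ∀ t ∈ Icc 0 l, γ t ∈ G ∧ Metric.ball (γ t) (a * (t + b) ^ s) ⊆ G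

theorem JohnPath.refl {E : Type*} [NormedAddCommGroup E] {G : Set E} {x₀ : E}
    {a s B b : ℝ} (hx : x₀ ∈ G) (hb : b ≤ B) (h : Metric.ball x₀ (a * b ^ s) ⊆ G) :
    JohnPath G x₀ a s B x₀ b := by
  refine ⟨0, fun _ => x₀, le_rfl, by simpa using hb, rfl, rfl, ?_, ?_⟩
  · rw [Icc_self]
    exact hasConstantSpeedOnWith_of_subsingleton _ subsingleton_singleton _
  · intro t ht
    have : t = 0 := by simpa using ht
    subst this
    exact ⟨hx, by simpa using h⟩

/-- The offset `b` stands for length already spent before reaching `x`. Paths can thus be built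
backwards from the root, one segment at a time: the clearance on the old tail persists as soon as
`b' + dist y x ≤ b`. -/
theorem JohnPath.prepend {E : Type*} [NormedAddCommGroup E] [NormedSpace ℝ E] {G : Set E}
    {x₀ : E} {a s B : ℝ} (ha : 0 ≤ a) (hs : 0 ≤ s) {x y : E} {b b' : ℝ}
    (h : JohnPath G x₀ a s B x b) (hb' : 0 ≤ b') (hb : b' + dist y x ≤ b)
    (H : ∀ θ ∈ Icc (0 : ℝ) 1, AffineMap.lineMap y x θ ∈ G ∧
      Metric.ball (AffineMap.lineMap y x θ) (a * (θ * dist y x + b') ^ s) ⊆ G) :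
    JohnPath G x₀ a s B y b' := by
  obtain ⟨l, γ, hl, hlB, hγ0, hγl, hspeed, hγ⟩ := h
  set L := dist y x with hL
  have hL0 : 0 ≤ L := dist_nonneg
  set seg : ℝ → E := fun t => AffineMap.lineMap y x (t / L) with hseg
  -- A segment of length zero is allowed: division by `L = 0` gives the parameter `0`, and then `y =
  -- x`.
  have hjoin : ∀ t, t = L → seg t = γ (t - L) := by
    rintro t rfl
    rcases hL0.eq_or_lt with h0 | h0
    · have hxy : y = x := dist_eq_zero.1 (by rw [← hL, ← h0])
      simp [hseg, hγ0, hxy]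
    · simp [hseg, hγ0, h0.ne']
  refine ⟨L + l, fun t => if t ≤ L then seg t else γ (t - L), by positivity, by linarith, ?_, ?_,
    ?_, ?_⟩
  · simp [hL0, hseg]
  · rcases hl.eq_or_lt with h0 | h0
    · subst h0
      have := hjoin L rfl
      simp only [add_zero, le_refl, if_true, this, sub_self, hγl]
    · have : ¬ (L + l ≤ L) := by linarith
      simp [this, hγl]
  · have h1 : HasUnitSpeedOn (fun t => if t ≤ L then seg t else γ (t - L)) (Icc 0 L) := by
      rcases hL0.eq_or_lt with h0 | h0
      · rw [← h0, Icc_self]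
        exact hasConstantSpeedOnWith_of_subsingleton _ subsingleton_singleton _
      · refine hasUnitSpeedOn_of_edist_eq ordConnected_Icc ?_
        intro t ht t' ht' htt'
        simp only [ht.2, ht'.2, if_true, hseg]
        rw [edist_dist, dist_lineMap_lineMap, ← hL, Real.dist_eq, abs_sub_comm, ← sub_div,
          abs_of_nonneg (div_nonneg (sub_nonneg.2 htt') hL0), div_mul_cancel₀ _ h0.ne']
    have h2 : HasUnitSpeedOn (fun t => if t ≤ L then seg t else γ (t - L)) (Icc L (L + l)) := by
      have h3 : HasUnitSpeedOn (fun t => γ (t - L)) (Icc L (L + l)) := hspeed.comp_sub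
      intro t ht t' ht'
      rw [← h3 ht ht']
      refine eVariationOn.congr ?_
      intro r hr
      rcases hr.1.1.eq_or_lt with h0 | h0
      · simp only [← h0, le_refl, if_true]
        exact hjoin L rfl
      · simp [not_le.2 h0]
    exact h1.Icc_Icc h2
  · intro t ht
    by_cases htL : t ≤ L
    · simp only [htL, if_true, hseg]
      rcases hL0.eq_or_lt with h0 | h0
      · have := H 0 ⟨le_rfl, zero_le_one⟩
        have ht0 : t = 0 := le_antisymm (by linarith) ht.1
        simpa [ht0] using this
      · have := H (t / L) ⟨div_nonneg ht.1 hL0, (div_le_one h0).2 htL⟩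
        rwa [div_mul_cancel₀ _ h0.ne'] at this
    · simp only [htL, if_false]
      push Not at htL
      obtain ⟨h1, h2⟩ := hγ (t - L) ⟨by linarith, by linarith [ht.2]⟩
      refine ⟨h1, (Metric.ball_subset_ball ?_).trans h2⟩
      exact mul_le_mul_of_nonneg_left
        (Real.rpow_le_rpow (by linarith [ht.1]) (by linarith) hs) ha

theorem le_infDist_frontier_of_ball_subset {E : Type*} [PseudoMetricSpace E] {G : Set E}
    (hG : IsOpen G) (hne : (frontier G).Nonempty) {x : E} {r : ℝ}
    (h : Metric.ball x r ⊆ G) : r ≤ Metric.infDist x (frontier G) := by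
  rw [Metric.le_infDist hne]
  intro y hy
  by_contra hlt
  push Not at hlt
  have : y ∈ G := h (by rwa [Metric.mem_ball, dist_comm])
  rw [hG.frontier_eq] at hy
  exact hy.2 this

theorem IsPreconnected.exists_mem_frontier {X : Type*} [TopologicalSpace X] {S G : Set X}
    (hS : IsPreconnected S) {x y : X} (hx : x ∈ S) (hxG : x ∈ G) (hy : y ∈ S) (hyG : y ∉ G) :
    ∃ z ∈ S, z ∈ frontier G := by
  by_contra! h
  have hmem : ∀ z ∈ S, z ∈ interior G ∨ z ∈ (closure G)ᶜ := by
    intro z hz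
    by_contra! hcon
    exact h z hz ⟨not_not.1 hcon.2, hcon.1⟩
  obtain ⟨z, -, hz1, hz2⟩ := hS (interior G) (closure G)ᶜ isOpen_interior
    isClosed_closure.isOpen_compl hmem
    ⟨x, hx, (hmem x hx).resolve_right fun h => h (subset_closure hxG)⟩
    ⟨y, hy, (hmem y hy).resolve_left fun h => hyG (interior_subset h)⟩
  exact hz2 (interior_subset_closure hz1)

theorem ball_infDist_frontier_subset {E : Type*} [NormedAddCommGroup E] [NormedSpace ℝ E]
    {G : Set E} {x : E} (hx : x ∈ G) :
    Metric.ball x (Metric.infDist x (frontier G)) ⊆ G := by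
  intro y hy
  by_contra hyG
  have hseg : IsPreconnected (segment ℝ x y) := (convex_segment x y).isPreconnected
  obtain ⟨z, hz, hzf⟩ := hseg.exists_mem_frontier (left_mem_segment ℝ x y) hx
    (right_mem_segment ℝ x y) hyG
  have h1 : Metric.infDist x (frontier G) ≤ dist x z := Metric.infDist_le_dist_of_mem hzf
  have h2 : z ∈ Metric.ball x (Metric.infDist x (frontier G)) := by
    have hpos : 0 < Metric.infDist x (frontier G) :=
      lt_of_le_of_lt dist_nonneg (Metric.mem_ball.1 hy)
    exact (convex_ball x _).segment_subset (Metric.mem_ball_self hpos) hy hz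
  rw [Metric.mem_ball, dist_comm] at h2
  linarith

theorem frontier_nonempty_of_isBounded {E : Type*} [NormedAddCommGroup E] [NormedSpace ℝ E]
    [Nontrivial E] {G : Set E} (hb : Bornology.IsBounded G) (hne : G.Nonempty) :
    (frontier G).Nonempty := by
  refine nonempty_frontier_iff.2 ⟨hne, ?_⟩
  rintro rfl
  exact NormedSpace.unbounded_univ ℝ E hb

/-- A bounded open set all of whose points are joined by `JohnPath`s to one point is John. -/
theorem isJohnDomain_of_johnPath {n : ℕ} [NeZero n] {s a B : ℝ}
    {G : Set (EuclideanSpace ℝ (Fin n))} (hs : 1 ≤ s) (ha : 0 < a) (hB : 0 < B) (hG : IsOpen G)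
    (hbd : Bornology.IsBounded G) {x₀ : EuclideanSpace ℝ (Fin n)} (hx₀ : x₀ ∈ G)
    (H : ∀ x ∈ G, JohnPath G x₀ a s B x 0) : IsJohnDomain s G := by
  have : Nontrivial (EuclideanSpace ℝ (Fin n)) := inferInstance
  have hne := frontier_nonempty_of_isBounded hbd ⟨x₀, hx₀⟩
  -- The John constant has to dominate both the length bound `B` and `a⁻¹`.
  refine ⟨hs, hG, ⟨⟨x₀, hx₀⟩, ?_⟩, hbd, x₀, hx₀, B + a⁻¹, by positivity, ?_⟩
  · refine isPreconnected_of_forall x₀ fun y hy => ?_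
    obtain ⟨l, γ, hl, -, h0, h1, hsp, hγ⟩ := H y hy
    refine ⟨γ '' Icc 0 l, ?_, ⟨l, right_mem_Icc.2 hl, h1⟩, ⟨0, left_mem_Icc.2 hl, h0⟩,
      isPreconnected_Icc.image _ hsp.continuousOn⟩
    rintro _ ⟨t, ht, rfl⟩
    exact (hγ t ht).1
  · intro x hx
    obtain ⟨l, γ, hl, hlB, h0, h1, hsp, hγ⟩ := H x hx
    refine ⟨l, γ, hl, ?_, h0, h1, fun t ht => (hγ t ht).1, hsp, ?_⟩
    · have : 0 < a⁻¹ := by positivity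
      linarith
    · intro t ht
      refine le_trans ?_ (le_infDist_frontier_of_ball_subset hG hne (hγ t ht).2)
      rw [add_zero, div_eq_inv_mul]
      have : 0 ≤ t ^ s := Real.rpow_nonneg ht.1 s
      gcongr
      rw [inv_le_comm₀ (by positivity) ha]
      linarith

end Paths

/-! ### The tree of rooms and tubes, in the sup norm -/

section TreeGeometry

/-- The sign attached to a Boolean. -/
def boolSign (b : Bool) : ℝ := if b then 1 else -1

/-- Open axis-parallel box with center `a` and half-widths `h`. -/
def axisBox {n : ℕ} (a h : Fin n → ℝ) : Set (Fin n → ℝ) := {x | ∀ i, |x i - a i| < h i}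

/-- The margin left around the child cubes of a unit cube. -/
noncomputable def margin (β : ℝ) : ℝ := (1 / 2 - β) / 4

/-- Center of the child cube in direction `σ` of the cube of half-side `β ^ k` about `c`. -/
noncomputable def child {n : ℕ} (β : ℝ) (c : Fin n → ℝ) (k : ℕ) (σ : Fin n → Bool) : Fin n → ℝ :=
  fun i => c i + β ^ k / 2 * boolSign (σ i)

/-- Half-widths of a room: a plate orthogonal to the direction `i₀`. -/
noncomputable def roomWidth {n : ℕ} (i₀ : Fin n) (β : ℝ) (k : ℕ) : Fin n → ℝ :=
  fun i => if i = i₀ then margin β * β ^ k else 3 / 4 * β ^ k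

noncomputable def room {n : ℕ} (i₀ : Fin n) (β : ℝ) (c : Fin n → ℝ) (k : ℕ) : Set (Fin n → ℝ) :=
  axisBox c (roomWidth i₀ β k)

/-- The point of the room about `c` at which the tube to the child in direction `σ` starts. -/
noncomputable def door {n : ℕ} (i₀ : Fin n) (β : ℝ) (c : Fin n → ℝ) (k : ℕ) (σ : Fin n → Bool) :
    Fin n → ℝ :=
  fun i => if i = i₀ then c i else child β c k σ i

noncomputable def tubeCenter {n : ℕ} (i₀ : Fin n) (β : ℝ) (c : Fin n → ℝ) (k : ℕ)
    (σ : Fin n → Bool) : Fin n → ℝ :=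
  fun i => if i = i₀ then c i + β ^ k / 4 * boolSign (σ i) else child β c k σ i

/-- The extra `ρ k` in the direction `i₀` keeps sup norm balls of radius `ρ k` about both ends of
the axis inside the tube. -/
noncomputable def tubeWidth {n : ℕ} (i₀ : Fin n) (β : ℝ) (ρ : ℕ → ℝ) (k : ℕ) : Fin n → ℝ :=
  fun i => if i = i₀ then β ^ k / 4 + ρ k else ρ k

/-- The tube of thickness `ρ k` joining the room about `c` to its child in direction `σ`. -/
noncomputable def tube {n : ℕ} (i₀ : Fin n) (β : ℝ) (ρ : ℕ → ℝ) (c : Fin n → ℝ) (k : ℕ)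
    (σ : Fin n → Bool) : Set (Fin n → ℝ) :=
  axisBox (tubeCenter i₀ β c k σ) (tubeWidth i₀ β ρ k)

/-- `InTree i₀ β ρ c k x`: the point `x` lies in a room or a tube of the tree with root room of
size `β ^ k` about `c`. -/
inductive InTree {n : ℕ} (i₀ : Fin n) (β : ℝ) (ρ : ℕ → ℝ) :
    (Fin n → ℝ) → ℕ → (Fin n → ℝ) → Prop
  | room {c : Fin n → ℝ} {k : ℕ} {x : Fin n → ℝ} :
      x ∈ room i₀ β c k → InTree i₀ β ρ c k x
  | tube {c : Fin n → ℝ} {k : ℕ} {x : Fin n → ℝ} (σ : Fin n → Bool) :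
      x ∈ tube i₀ β ρ c k σ → InTree i₀ β ρ c k x
  | sub {c : Fin n → ℝ} {k : ℕ} {x : Fin n → ℝ} (σ : Fin n → Bool) :
      InTree i₀ β ρ (child β c k σ) (k + 1) x → InTree i₀ β ρ c k x

open Classical in
/-- The centers of the rooms of generation `k`. -/
noncomputable def nodes (n : ℕ) (β : ℝ) : ℕ → Finset (Fin n → ℝ)
  | 0 => {0}
  | k + 1 => (nodes n β k ×ˢ (Finset.univ : Finset (Fin n → Bool))).image
      fun q => child β q.1 k q.2

/-- The exponent `k + 1` in `thick_le` is needed because a tube ends at the centre of the child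
cube, where it must fit in the gap between the grandchildren. -/
structure TreeParams (β : ℝ) (ρ : ℕ → ℝ) : Prop where
  pos : 0 < β
  lt_half : β < 1 / 2
  thick_pos : ∀ k, 0 < ρ k
  thick_le : ∀ k, ρ k ≤ margin β * β ^ (k + 1)

variable {n : ℕ} {i₀ : Fin n} {β : ℝ} {ρ : ℕ → ℝ} {c x : Fin n → ℝ} {k : ℕ} {σ τ : Fin n → Bool}

theorem boolSign_cases (b : Bool) : boolSign b = 1 ∨ boolSign b = -1 := by
  cases b <;> simp [boolSign]

theorem boolSign_ne {a b : Bool} (h : a ≠ b) :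
    boolSign a = 1 ∧ boolSign b = -1 ∨ boolSign a = -1 ∧ boolSign b = 1 := by
  cases a <;> cases b <;> simp_all [boolSign]

namespace TreeParams


theorem margin_pos (P : TreeParams β ρ) : 0 < margin β := by have := P.lt_half; unfold margin; linarith

theorem pow_pos (P : TreeParams β ρ) (k : ℕ) : 0 < β ^ k := _root_.pow_pos P.pos k

theorem pow_succ_lt (P : TreeParams β ρ) (k : ℕ) : β ^ (k + 1) < β ^ k / 2 := by
  rw [pow_succ]; have := P.pow_pos k; nlinarith [P.lt_half]

theorem two_mul_thick_lt (P : TreeParams β ρ) (k : ℕ) : 2 * ρ k < margin β * β ^ k := by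
  have h1 := P.thick_le k
  have h2 := mul_lt_mul_of_pos_left (P.pow_succ_lt k) P.margin_pos
  linarith

theorem thick_lt (P : TreeParams β ρ) (k : ℕ) : ρ k < β ^ k / 16 := by
  have h1 := P.two_mul_thick_lt k
  have h2 : margin β < 1 / 8 := by unfold margin; linarith [P.pos]
  have := mul_lt_mul_of_pos_right h2 (P.pow_pos k)
  linarith

theorem margin_mul (β : ℝ) (k : ℕ) : margin β * β ^ k = β ^ k / 8 - β ^ (k + 1) / 4 := by
  unfold margin; rw [pow_succ]; ring

end TreeParams

theorem mem_closedBall_pi {r : ℝ} (hr : 0 ≤ r) :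
    x ∈ Metric.closedBall c r ↔ ∀ i, |x i - c i| ≤ r := by
  rw [Metric.mem_closedBall, dist_pi_le_iff hr]; rfl

/-- The cube about a child of `c`, enlarged by three margins. -/
noncomputable def bigCube {n : ℕ} (β : ℝ) (c : Fin n → ℝ) (k : ℕ) (σ : Fin n → Bool) :
    Set (Fin n → ℝ) :=
  Metric.closedBall (child β c k σ) (β ^ (k + 1) + 3 * (margin β * β ^ k))

/-- The gap between a child cube and the mid-hyperplanes of its parent is four margins; the
enlargement uses three and leaves one. -/
theorem TreeParams.bigRadius_eq (β : ℝ) (k : ℕ) :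
    β ^ (k + 1) + 3 * (margin β * β ^ k) = β ^ k / 2 - margin β * β ^ k := by
  rw [TreeParams.margin_mul]; ring

theorem mem_bigCube (P : TreeParams β ρ) : x ∈ bigCube β c k σ ↔
    ∀ i, |x i - (c i + β ^ k / 2 * boolSign (σ i))| ≤ β ^ k / 2 - margin β * β ^ k := by
  have h1 := P.pow_pos (k + 1)
  have h2 := mul_pos P.margin_pos (P.pow_pos k)
  rw [bigCube, mem_closedBall_pi (by positivity), TreeParams.bigRadius_eq]; rfl

theorem closedBall_child_subset_bigCube (P : TreeParams β ρ) :
    Metric.closedBall (child β c k σ) (β ^ (k + 1)) ⊆ bigCube β c k σ :=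
  Metric.closedBall_subset_closedBall (by have := mul_pos P.margin_pos (P.pow_pos k); linarith)

theorem bigCube_subset (P : TreeParams β ρ) :
    bigCube β c k σ ⊆ Metric.closedBall c (β ^ k) := by
  intro x hx
  have hr := P.pow_pos k
  have hm := mul_pos P.margin_pos hr
  rw [mem_bigCube P] at hx
  rw [mem_closedBall_pi hr.le]
  intro i
  have := abs_le.1 (hx i)
  rw [abs_le]
  rcases boolSign_cases (σ i) with h | h <;> rw [h] at this <;> constructor <;> linarith

theorem closedBall_child_subset (P : TreeParams β ρ) :
    Metric.closedBall (child β c k σ) (β ^ (k + 1)) ⊆ Metric.closedBall c (β ^ k) :=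
  (closedBall_child_subset_bigCube P).trans (bigCube_subset P)

theorem disjoint_bigCube (P : TreeParams β ρ) (h : σ ≠ τ) :
    Disjoint (bigCube β c k σ) (bigCube β c k τ) := by
  rw [Set.disjoint_left]
  intro x hx hy
  obtain ⟨i, hi⟩ := Function.ne_iff.1 h
  have hm := mul_pos P.margin_pos (P.pow_pos k)
  have h1 := abs_le.1 ((mem_bigCube P).1 hx i)
  have h2 := abs_le.1 ((mem_bigCube P).1 hy i)
  rcases boolSign_ne hi with ⟨ha, hb⟩ | ⟨ha, hb⟩ <;> rw [ha] at h1 <;> rw [hb] at h2 <;> linarith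

theorem room_subset_closedBall (P : TreeParams β ρ) :
    room i₀ β c k ⊆ Metric.closedBall c (β ^ k) := by
  intro x hx
  have hr := P.pow_pos k
  rw [mem_closedBall_pi hr.le]
  intro i
  have := hx i
  have h1 := TreeParams.margin_mul β k
  have h2 := P.pow_pos (k + 1)
  unfold roomWidth at this
  split_ifs at this <;> linarith

/-- In the coordinate `i₀` the plate occupies exactly the one margin that the enlarged cubes leave
free. -/
theorem disjoint_room_bigCube (P : TreeParams β ρ) :
    Disjoint (room i₀ β c k) (bigCube β c k σ) := by
  rw [Set.disjoint_left]
  intro x hx hy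
  have h1 := hx i₀
  have h2 := abs_le.1 ((mem_bigCube P).1 hy i₀)
  rw [roomWidth, if_pos rfl, abs_lt] at h1
  rcases boolSign_cases (σ i₀) with h | h <;> rw [h] at h2 <;> linarith

theorem tube_subset_closedBall (P : TreeParams β ρ) :
    tube i₀ β ρ c k σ ⊆ Metric.closedBall c (β ^ k) := by
  intro x hx
  have hr := P.pow_pos k
  rw [mem_closedBall_pi hr.le]
  intro i
  have := hx i
  have h1 := P.thick_lt k
  unfold tubeWidth tubeCenter child at this
  rw [abs_le]
  split_ifs at this <;> rw [abs_lt] at this <;>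
    rcases boolSign_cases (σ i) with h | h <;> rw [h] at this <;> constructor <;> linarith

/-- In a coordinate where `σ` and `τ` differ, the tube passes the mid-hyperplane by at most `ρ k`,
which is less than the margin that the other cube keeps from it. -/
theorem disjoint_tube_bigCube (P : TreeParams β ρ) (h : σ ≠ τ) :
    Disjoint (tube i₀ β ρ c k σ) (bigCube β c k τ) := by
  rw [Set.disjoint_left]
  intro x hx hy
  obtain ⟨i, hi⟩ := Function.ne_iff.1 h
  have h0 := P.two_mul_thick_lt k
  have h3 := P.thick_pos k
  have hr := P.pow_pos k
  have h1 := hx i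
  have h2 := abs_le.1 ((mem_bigCube P).1 hy i)
  unfold tubeWidth tubeCenter child at h1
  split_ifs at h1 <;> rw [abs_lt] at h1 <;>
  rcases boolSign_ne hi with ⟨ha, hb⟩ | ⟨ha, hb⟩ <;> rw [ha] at h1 <;> rw [hb] at h2 <;> linarith

/-- In a transversal coordinate `i₁` the tube stays within `ρ k` of the child's centre, and the
enlarged grandchildren keep one margin of generation `k + 1` away from it. Such a coordinate exists
because `2 ≤ n`. -/
theorem disjoint_tube_bigCube_child (P : TreeParams β ρ) {i₁ : Fin n} (hi : i₁ ≠ i₀) :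
    Disjoint (tube i₀ β ρ c k σ) (bigCube β (child β c k σ) (k + 1) τ) := by
  rw [Set.disjoint_left]
  intro x hx hy
  have h0 := P.thick_le k
  have h1 := hx i₁
  have h2 := abs_le.1 ((mem_bigCube P).1 hy i₁)
  unfold tubeWidth tubeCenter at h1
  rw [if_neg hi, if_neg hi, abs_lt] at h1
  rcases boolSign_cases (τ i₁) with h | h <;> rw [h] at h2 <;> linarith

theorem InTree.mem_closedBall (P : TreeParams β ρ) (h : InTree i₀ β ρ c k x) :
    x ∈ Metric.closedBall c (β ^ k) := by
  induction h with
  | room h => exact room_subset_closedBall P h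
  | tube σ h => exact tube_subset_closedBall P h
  | sub σ _ ih => exact closedBall_child_subset P ih

theorem mem_nodes_succ {y : Fin n → ℝ} :
    y ∈ nodes n β (k + 1) ↔ ∃ c ∈ nodes n β k, ∃ σ, y = child β c k σ := by
  simp only [nodes, Finset.mem_image, Finset.mem_product, Finset.mem_univ, and_true, Prod.exists]
  constructor
  · rintro ⟨a, b, h, rfl⟩; exact ⟨a, h, b, rfl⟩
  · rintro ⟨a, h, b, rfl⟩; exact ⟨a, b, h, rfl⟩

theorem child_mem_nodes (h : c ∈ nodes n β k) (σ : Fin n → Bool) :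
    child β c k σ ∈ nodes n β (k + 1) := mem_nodes_succ.2 ⟨c, h, σ, rfl⟩

/-- The domain, in coordinates. -/
def treeDomain (i₀ : Fin n) (β : ℝ) (ρ : ℕ → ℝ) : Set (Fin n → ℝ) := {x | InTree i₀ β ρ 0 0 x}

theorem InTree.mem_treeDomain (hc : c ∈ nodes n β k) (h : InTree i₀ β ρ c k x) :
    x ∈ treeDomain i₀ β ρ := by
  induction k generalizing c with
  | zero =>
    have : c = 0 := by simpa [nodes] using hc
    subst this; exact h
  | succ k ih =>
    obtain ⟨d, hd, σ, rfl⟩ := mem_nodes_succ.1 hc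
    exact ih hd (.sub σ h)

theorem InTree.exists_node (hc : c ∈ nodes n β k) (h : InTree i₀ β ρ c k x) :
    ∃ j, ∃ d ∈ nodes n β j, x ∈ _root_.room i₀ β d j ∨ ∃ σ, x ∈ _root_.tube i₀ β ρ d j σ := by
  induction h with
  | @room c k _ h => exact ⟨k, c, hc, Or.inl h⟩
  | @tube c k _ σ h => exact ⟨k, c, hc, Or.inr ⟨σ, h⟩⟩
  | sub σ _ ih => exact ih (child_mem_nodes hc σ)

theorem mem_treeDomain_iff : x ∈ treeDomain i₀ β ρ ↔
    ∃ j, ∃ d ∈ nodes n β j, x ∈ room i₀ β d j ∨ ∃ σ, x ∈ tube i₀ β ρ d j σ := by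
  constructor
  · exact fun h => InTree.exists_node (by simp [nodes]) h
  · rintro ⟨j, d, hd, h | ⟨σ, h⟩⟩
    exacts [(InTree.room h).mem_treeDomain hd, (InTree.tube σ h).mem_treeDomain hd]

/-- The union of the closed cubes of generation `k`. -/
def cubes (n : ℕ) (β : ℝ) (k : ℕ) : Set (Fin n → ℝ) :=
  ⋃ c ∈ nodes n β k, Metric.closedBall c (β ^ k)

/-- Truncation of the tree at depth `k`: beyond the cubes of generation `k`, only finitely many
boxes remain. -/
theorem mem_cubes_or_exists (P : TreeParams β ρ) (hx : x ∈ treeDomain i₀ β ρ) (k : ℕ) :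
    x ∈ cubes n β k ∨ ∃ j < k, ∃ d ∈ nodes n β j,
      x ∈ room i₀ β d j ∨ ∃ σ, x ∈ tube i₀ β ρ d j σ := by
  have : (∃ c ∈ nodes n β k, InTree i₀ β ρ c k x) ∨ ∃ j < k, ∃ d ∈ nodes n β j,
      x ∈ room i₀ β d j ∨ ∃ σ, x ∈ tube i₀ β ρ d j σ := by
    induction k with
    | zero => exact Or.inl ⟨0, by simp [nodes], hx⟩
    | succ k ih =>
      rcases ih with ⟨c, hc, h⟩ | ⟨j, hj, h⟩
      · cases h with
        | room h => exact Or.inr ⟨k, k.lt_succ_self, c, hc, Or.inl h⟩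
        | tube σ h => exact Or.inr ⟨k, k.lt_succ_self, c, hc, Or.inr ⟨σ, h⟩⟩
        | sub σ h => exact Or.inl ⟨_, child_mem_nodes hc σ, h⟩
      · exact Or.inr ⟨j, hj.trans k.lt_succ_self, h⟩
  refine this.imp_left ?_
  rintro ⟨c, hc, h⟩
  exact mem_iUnion₂.2 ⟨c, hc, h.mem_closedBall P⟩

theorem cubes_succ_subset (P : TreeParams β ρ) (k : ℕ) : cubes n β (k + 1) ⊆ cubes n β k := by
  intro x hx
  obtain ⟨c, hc, h⟩ := mem_iUnion₂.1 hx
  obtain ⟨d, hd, σ, rfl⟩ := mem_nodes_succ.1 hc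
  exact mem_iUnion₂.2 ⟨d, hd, closedBall_child_subset P h⟩

theorem cubes_antitone (P : TreeParams β ρ) : Antitone (cubes n β) :=
  antitone_nat_of_succ_le (cubes_succ_subset P)

/-- Near a cube of generation `k + 1`, but outside of it, the domain coincides with the tube leading
to that cube. -/
theorem inTree_or_mem_tube (P : TreeParams β ρ) {i₁ : Fin n} (hi : i₁ ≠ i₀)
    (hc : c ∈ nodes n β k) (hx : x ∈ treeDomain i₀ β ρ) (hxc : x ∈ bigCube β c k σ) :
    InTree i₀ β ρ (child β c k σ) (k + 1) x ∨ x ∈ tube i₀ β ρ c k σ := by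
  have key : ∀ {c : Fin n → ℝ} {k : ℕ} {σ : Fin n → Bool}, x ∈ bigCube β c k σ →
      InTree i₀ β ρ c k x →
      InTree i₀ β ρ (child β c k σ) (k + 1) x ∨ x ∈ tube i₀ β ρ c k σ := by
    intro c k σ hxc h
    cases h with
    | room h => exact absurd hxc ((disjoint_room_bigCube P).notMem_of_mem_left h)
    | tube τ h =>
      by_cases hτ : τ = σ
      · exact Or.inr (hτ ▸ h)
      · exact absurd hxc ((disjoint_tube_bigCube P hτ).notMem_of_mem_left h)
    | sub τ h =>
      by_cases hτ : τ = σ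
      · exact Or.inl (hτ ▸ h)
      · exact absurd hxc ((disjoint_bigCube P hτ).notMem_of_mem_left
          (closedBall_child_subset_bigCube P (h.mem_closedBall P)))
  induction k generalizing c σ with
  | zero =>
    have : c = 0 := by simpa [nodes] using hc
    subst this
    exact key hxc hx
  | succ k ih =>
    obtain ⟨d, hd, τ, rfl⟩ := mem_nodes_succ.1 hc
    -- One generation up, the point is in the subtree about `child β d k τ` or in the tube leading
    -- to that node; the tube misses the enlarged cubes of the next generation.
    rcases ih hd (closedBall_child_subset_bigCube P (bigCube_subset P hxc)) with h | h
    · exact key hxc h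
    · exact absurd hxc ((disjoint_tube_bigCube_child P hi).notMem_of_mem_left h)

theorem pairwiseDisjoint_nodes (P : TreeParams β ρ) (k : ℕ) :
    (nodes n β k : Set (Fin n → ℝ)).PairwiseDisjoint fun c => Metric.closedBall c (β ^ k) := by
  induction k with
  | zero => simp [nodes]
  | succ k ih =>
    intro a ha b hb hab
    obtain ⟨c, hc, σ, rfl⟩ := mem_nodes_succ.1 (Finset.mem_coe.1 ha)
    obtain ⟨d, hd, τ, rfl⟩ := mem_nodes_succ.1 (Finset.mem_coe.1 hb)
    by_cases hcd : c = d
    · subst hcd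
      exact (disjoint_bigCube P (fun h => hab (by rw [h]))).mono
        (closedBall_child_subset_bigCube P) (closedBall_child_subset_bigCube P)
    · exact (ih hc hd hcd).mono (closedBall_child_subset P) (closedBall_child_subset P)

theorem card_nodes (P : TreeParams β ρ) (k : ℕ) : (nodes n β k).card = (2 ^ n) ^ k := by
  induction k with
  | zero => simp [nodes]
  | succ k ih =>
    rw [nodes, Finset.card_image_of_injOn, Finset.card_product, ih, pow_succ]
    · simp
    · rintro ⟨c, σ⟩ h1 ⟨d, τ⟩ h2 h
      simp only [Finset.coe_product, mem_prod, Finset.mem_coe] at h1 h2 h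
      have hmem : child β c k σ ∈ Metric.closedBall (child β c k σ) (β ^ (k + 1)) :=
        Metric.mem_closedBall_self (P.pow_pos _).le
      have hcd : c = d := by
        by_contra hcd
        refine (pairwiseDisjoint_nodes P k h1.1 h2.1 hcd).notMem_of_mem_left
          (closedBall_child_subset P hmem) ?_
        rw [h] at hmem ⊢
        exact closedBall_child_subset P hmem
      subst hcd
      have hst : σ = τ := by
        by_contra hst
        refine (disjoint_bigCube P hst).notMem_of_mem_left
          (closedBall_child_subset_bigCube P hmem) ?_
        rw [h] at hmem ⊢
        exact closedBall_child_subset_bigCube P hmem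
      rw [hst]

end TreeGeometry

/-! ### The domain in Euclidean space -/

section TreeSet

variable {n : ℕ} {i₀ : Fin n} {β : ℝ} {ρ : ℕ → ℝ} {c : Fin n → ℝ} {k : ℕ} {σ : Fin n → Bool}

theorem axisBox_eq_pi (a h : Fin n → ℝ) :
    axisBox a h = univ.pi fun i => Ioo (a i - h i) (a i + h i) := by
  ext x
  simp only [axisBox, mem_ofPred_eq, mem_univ_pi, mem_Ioo, abs_lt]
  refine forall_congr' fun i => ?_
  constructor <;> rintro ⟨h1, h2⟩ <;> constructor <;> linarith

theorem isOpen_axisBox (a h : Fin n → ℝ) : IsOpen (axisBox a h) := by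
  rw [axisBox_eq_pi]
  exact isOpen_set_pi finite_univ fun _ _ => isOpen_Ioo

theorem volume_axisBox (a h : Fin n → ℝ) :
    volume (axisBox a h) = ∏ i, ENNReal.ofReal (2 * h i) := by
  rw [axisBox_eq_pi, Real.volume_pi_Ioo]
  refine Finset.prod_congr rfl fun i _ => ?_
  ring_nf

theorem isOpen_treeDomain : IsOpen (treeDomain i₀ β ρ) := by
  have : treeDomain i₀ β ρ = ⋃ j, ⋃ d ∈ nodes n β j,
      (room i₀ β d j ∪ ⋃ σ, tube i₀ β ρ d j σ) := by
    ext x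
    simp only [mem_treeDomain_iff, mem_iUnion, mem_union, exists_prop]
  rw [this]
  exact isOpen_iUnion fun j => isOpen_biUnion fun d _ =>
    (isOpen_axisBox _ _).union (isOpen_iUnion fun σ => isOpen_axisBox _ _)

/-- The domain in Euclidean space. -/
def treeSet (i₀ : Fin n) (β : ℝ) (ρ : ℕ → ℝ) : Set (EuclideanSpace ℝ (Fin n)) :=
  WithLp.ofLp ⁻¹' treeDomain i₀ β ρ

theorem isOpen_treeSet : IsOpen (treeSet i₀ β ρ) :=
  isOpen_treeDomain.preimage (PiLp.continuous_ofLp 2 _)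

theorem abs_apply_sub_le_dist (x y : EuclideanSpace ℝ (Fin n)) (i : Fin n) :
    |x i - y i| ≤ dist x y := by
  rw [dist_eq_norm]
  simpa using PiLp.norm_apply_le (x - y) i

theorem dist_ofLp_le (x y : EuclideanSpace ℝ (Fin n)) : dist x.ofLp y.ofLp ≤ dist x y :=
  (dist_pi_le_iff dist_nonneg).2 fun i => abs_apply_sub_le_dist x y i

theorem dist_le_of_abs_apply_sub_le {x y : EuclideanSpace ℝ (Fin n)} {r : ℝ}
    (h : ∀ i, |x i - y i| ≤ r) : dist x y ≤ n * r := by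
  rcases Nat.eq_zero_or_pos n with rfl | hn
  · have : x = y := by ext i; exact i.elim0
    simp [this]
  have hr : 0 ≤ r := (abs_nonneg _).trans (h ⟨0, hn⟩)
  rw [EuclideanSpace.dist_eq]
  refine Real.sqrt_le_iff.2 ⟨by positivity, ?_⟩
  calc ∑ i, dist (x i) (y i) ^ 2 ≤ ∑ i : Fin n, r ^ 2 :=
        Finset.sum_le_sum fun i _ => by
          rw [Real.dist_eq]; exact pow_le_pow_left₀ (abs_nonneg _) (h i) 2
    _ = n * r ^ 2 := by simp
    _ ≤ (n * r) ^ 2 := by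
        have : (1 : ℝ) ≤ n := by exact_mod_cast hn
        rw [mul_pow]
        exact mul_le_mul_of_nonneg_right (by nlinarith) (sq_nonneg r)

theorem isBounded_treeSet (P : TreeParams β ρ) : Bornology.IsBounded (treeSet i₀ β ρ) := by
  refine (Metric.isBounded_closedBall (x := (0 : EuclideanSpace ℝ (Fin n)))
    (r := n * 1)).subset fun x hx => ?_
  have := InTree.mem_closedBall P hx
  rw [mem_closedBall_pi (P.pow_pos 0).le] at this
  exact dist_le_of_abs_apply_sub_le fun i => by simpa using this i

/-- Balls of `EuclideanSpace` are contained in sup norm balls. -/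
theorem ball_subset_preimage {S : Set (Fin n → ℝ)} {y : EuclideanSpace ℝ (Fin n)} {r : ℝ}
    (h : ∀ z : Fin n → ℝ, (∀ i, |z i - y i| < r) → z ∈ S) :
    Metric.ball y r ⊆ WithLp.ofLp ⁻¹' S := fun z hz =>
  h z.ofLp fun i => (abs_apply_sub_le_dist z y i).trans_lt hz

theorem lineMap_ofLp_apply (y x : EuclideanSpace ℝ (Fin n)) (θ : ℝ) (i : Fin n) :
    (AffineMap.lineMap y x θ : EuclideanSpace ℝ (Fin n)) i = y i + θ * (x i - y i) := by
  simp [AffineMap.lineMap_apply, add_comm]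

/-! ### The John condition for the tree -/

section John

variable {a s : ℝ}

/-- A leg in generation `k` costs at most one unit `n * β ^ k`. The elapsed length is at most four
units throughout, so the single clearance `ρ k` serves for the whole leg. -/
theorem TreeParams.johnPath_step (P : TreeParams β ρ) (ha : 0 ≤ a) (hs : 1 ≤ s)
    (hρ : a * (4 * n * β ^ k) ^ s ≤ ρ k) {x₀ x y : EuclideanSpace ℝ (Fin n)} {b b' B : ℝ}
    (h : JohnPath (treeSet i₀ β ρ) x₀ a s B x b) (hb : b ≤ 4 * n * β ^ k) (hb' : 0 ≤ b')
    (hbb' : b' + n * β ^ k ≤ b) (hxy : ∀ i, |y i - x i| ≤ β ^ k)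
    (H : ∀ θ ∈ Icc (0 : ℝ) 1, ∀ z : Fin n → ℝ,
      (∀ i, |z i - (y i + θ * (x i - y i))| < ρ k) → z ∈ treeDomain i₀ β ρ) :
    JohnPath (treeSet i₀ β ρ) x₀ a s B y b' := by
  have hd : dist y x ≤ n * β ^ k := dist_le_of_abs_apply_sub_le hxy
  refine h.prepend ha (by linarith) hb' (by linarith) fun θ hθ => ?_
  have hball : Metric.ball (AffineMap.lineMap y x θ) (ρ k) ⊆ treeSet i₀ β ρ :=
    ball_subset_preimage fun z hz => H θ hθ z fun i => by
      rw [← lineMap_ofLp_apply]; exact hz i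
  refine ⟨hball (Metric.mem_ball_self (P.thick_pos k)), (Metric.ball_subset_ball ?_).trans hball⟩
  refine le_trans (mul_le_mul_of_nonneg_left (Real.rpow_le_rpow ?_ ?_ (by linarith)) ha) hρ
  · have := mul_nonneg hθ.1 (dist_nonneg (x := y) (y := x)); linarith
  · have := mul_le_of_le_one_left (dist_nonneg (x := y) (y := x)) hθ.2; linarith

/-- The first leg may start next to a wall. By convexity, the point at fraction `θ` of the way to
the centre has clearance `θ * ρ k`, and `θ ^ s ≤ θ` because `1 ≤ s`. -/
theorem TreeParams.johnPath_axisBox (P : TreeParams β ρ) (ha : 0 ≤ a) (hs : 1 ≤ s)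
    (hρ : a * (4 * n * β ^ k) ^ s ≤ ρ k) {x₀ x y : EuclideanSpace ℝ (Fin n)} {b B : ℝ}
    (h : JohnPath (treeSet i₀ β ρ) x₀ a s B x b) (hb : n * β ^ k ≤ b) {w : Fin n → ℝ}
    (hw : ∀ i, ρ k ≤ w i) (hw' : ∀ i, w i ≤ β ^ k) (hy : y.ofLp ∈ axisBox x.ofLp w)
    (H : axisBox x.ofLp w ⊆ treeDomain i₀ β ρ) :
    JohnPath (treeSet i₀ β ρ) x₀ a s B y 0 := by
  have hd : dist y x ≤ n * β ^ k :=
    dist_le_of_abs_apply_sub_le fun i => (hy i).le.trans (hw' i)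
  refine h.prepend ha (by linarith) le_rfl (by linarith) fun θ hθ => ?_
  have hk := P.thick_pos k
  have hmem : (AffineMap.lineMap y x θ : EuclideanSpace ℝ (Fin n)) ∈ treeSet i₀ β ρ := by
    refine H fun i => ?_
    have hi : |y i - x i| < w i := hy i
    have : y i + θ * (x i - y i) - x i = (1 - θ) * (y i - x i) := by ring
    rw [lineMap_ofLp_apply, this, abs_mul, abs_of_nonneg (by linarith [hθ.2])]
    exact (mul_le_of_le_one_left (abs_nonneg _) (by linarith [hθ.1])).trans_lt hi
  have hball : Metric.ball (AffineMap.lineMap y x θ) (θ * ρ k) ⊆ treeSet i₀ β ρ := by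
    refine ball_subset_preimage fun z hz => H fun i => ?_
    have hi : |y i - x i| < w i := hy i
    have hzi := hz i
    rw [lineMap_ofLp_apply] at hzi
    have hθ0 : 0 < θ := by
      by_contra hcon
      have : θ = 0 := le_antisymm (not_lt.1 hcon) hθ.1
      have hlt := (abs_nonneg _).trans_lt hzi
      rw [this, zero_mul] at hlt
      exact hlt.false
    have heq : z i - x i = (z i - (y i + θ * (x i - y i))) + (1 - θ) * (y i - x i) := by ring
    rw [heq]
    refine (abs_add_le _ _).trans_lt ?_
    rw [abs_mul, abs_of_nonneg (by linarith [hθ.2] : 0 ≤ 1 - θ)]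
    have h1 : (1 - θ) * |y i - x i| ≤ (1 - θ) * w i :=
      mul_le_mul_of_nonneg_left hi.le (by linarith [hθ.2])
    have h2 := mul_le_mul_of_nonneg_left (hw i) hθ.1
    linarith
  refine ⟨hmem, (Metric.ball_subset_ball ?_).trans hball⟩
  rw [add_zero, Real.mul_rpow hθ.1 dist_nonneg]
  have h1 : θ ^ s ≤ θ := by
    simpa using Real.rpow_le_rpow_of_exponent_ge' hθ.1 hθ.2 zero_le_one hs
  have h2 : a * dist y x ^ s ≤ ρ k := by
    refine le_trans (mul_le_mul_of_nonneg_left (Real.rpow_le_rpow dist_nonneg ?_ ?_) ha) hρ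
    · have : 0 ≤ n * β ^ k := mul_nonneg n.cast_nonneg (P.pow_pos k).le
      linarith
    · linarith
  calc a * (θ ^ s * dist y x ^ s) = θ ^ s * (a * dist y x ^ s) := by ring
    _ ≤ θ * ρ k := mul_le_mul h1 h2 (mul_nonneg ha (Real.rpow_nonneg dist_nonneg _)) hθ.1

theorem room_subset_treeDomain (hc : c ∈ nodes n β k) : room i₀ β c k ⊆ treeDomain i₀ β ρ :=
  fun _ h => (InTree.room h).mem_treeDomain hc

theorem tube_subset_treeDomain (hc : c ∈ nodes n β k) :
    tube i₀ β ρ c k σ ⊆ treeDomain i₀ β ρ :=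
  fun _ h => (InTree.tube σ h).mem_treeDomain hc

/-- A point of the axis of a tube, written in terms of the fraction `φ` of its length. -/
theorem mem_tube_of_near_axis {z : Fin n → ℝ} {φ : ℝ} (P : TreeParams β ρ)
    (hφ : φ ∈ Icc (0 : ℝ) 1)
    (h₀ : |z i₀ - (c i₀ + φ * (β ^ k / 2 * boolSign (σ i₀)))| < ρ k)
    (h : ∀ i ≠ i₀, |z i - child β c k σ i| < ρ k) : z ∈ tube i₀ β ρ c k σ := by
  intro i
  have hr := P.pow_pos k
  unfold tubeWidth tubeCenter
  split_ifs with hi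
  · subst hi
    have h1 := mul_le_mul_of_nonneg_right hφ.2 hr.le
    have h2 := mul_nonneg hφ.1 hr.le
    rw [abs_lt] at h₀ ⊢
    rcases boolSign_cases (σ i) with hs | hs <;> rw [hs] at h₀ ⊢ <;> constructor <;> linarith
  · exact h i hi

theorem TreeParams.johnPath_door (P : TreeParams β ρ) (ha : 0 ≤ a) (hs : 1 ≤ s)
    (hρ : a * (4 * n * β ^ k) ^ s ≤ ρ k) {x₀ : EuclideanSpace ℝ (Fin n)} {B : ℝ}
    (hc : c ∈ nodes n β k)
    (h : JohnPath (treeSet i₀ β ρ) x₀ a s B (WithLp.toLp 2 c) (4 * n * β ^ k)) :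
    JohnPath (treeSet i₀ β ρ) x₀ a s B (WithLp.toLp 2 (door i₀ β c k σ)) (3 * n * β ^ k) := by
  have hr := P.pow_pos k
  have hn : (0 : ℝ) ≤ n := n.cast_nonneg
  refine P.johnPath_step ha hs hρ h le_rfl (by positivity) (by linarith) ?_ ?_
  · intro i
    simp only [door, child]
    rw [abs_le]
    split_ifs <;> rcases boolSign_cases (σ i) with h | h <;> try rw [h]
    all_goals constructor <;> linarith
  · intro θ hθ z hz
    refine room_subset_treeDomain hc fun i => ?_
    have hi := hz i
    have h1 := P.two_mul_thick_lt k
    have h2 := P.thick_lt k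
    have h3 := P.thick_pos k
    have h4 := mul_nonneg hθ.1 hr.le
    have h5 := mul_le_mul_of_nonneg_right hθ.2 hr.le
    simp only [door, child] at hi
    unfold roomWidth
    rw [abs_lt] at hi ⊢
    split_ifs at hi ⊢ <;> rcases boolSign_cases (σ i) with h | h <;> try rw [h] at hi
    all_goals constructor <;> linarith

/-- The budget closes up because `β < 1 / 2` gives `4 * n * β ^ (k + 1) ≤ 2 * n * β ^ k`: at most
two units are spent at the child, three at the door, four at the parent's centre. -/
theorem TreeParams.johnPath_child (P : TreeParams β ρ) (ha : 0 ≤ a) (hs : 1 ≤ s)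
    (hρ : a * (4 * n * β ^ k) ^ s ≤ ρ k) {x₀ : EuclideanSpace ℝ (Fin n)} {B : ℝ}
    (hc : c ∈ nodes n β k)
    (h : JohnPath (treeSet i₀ β ρ) x₀ a s B (WithLp.toLp 2 c) (4 * n * β ^ k)) :
    JohnPath (treeSet i₀ β ρ) x₀ a s B (WithLp.toLp 2 (child β c k σ))
      (4 * n * β ^ (k + 1)) := by
  have hr := P.pow_pos k
  have hr' := P.pow_pos (k + 1)
  have hn : (0 : ℝ) ≤ n := n.cast_nonneg
  have h0 := mul_le_mul_of_nonneg_left (P.pow_succ_lt k).le hn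
  refine P.johnPath_step ha hs hρ (P.johnPath_door (σ := σ) ha hs hρ hc h) ?_ (by positivity)
    (by linarith) ?_ ?_
  · have := mul_nonneg hn hr.le; linarith
  · intro i
    simp only [door, child]
    rw [abs_le]
    split_ifs <;> rcases boolSign_cases (σ i) with h | h <;> try rw [h]
    all_goals constructor <;> linarith
  · intro θ hθ z hz
    -- The path goes from the child to the door, against the parametrization of the axis.
    refine tube_subset_treeDomain hc (mem_tube_of_near_axis P (φ := 1 - θ) (σ := σ)
      ⟨by linarith [hθ.2], by linarith [hθ.1]⟩ ?_ fun i hi => ?_)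
    · convert hz i₀ using 2
      simp only [door, child, if_true]; ring
    · convert hz i using 2
      simp only [door, child, if_neg hi]; ring

theorem TreeParams.johnPath_tubeCenter (P : TreeParams β ρ) (ha : 0 ≤ a) (hs : 1 ≤ s)
    (hρ : a * (4 * n * β ^ k) ^ s ≤ ρ k) {x₀ : EuclideanSpace ℝ (Fin n)} {B : ℝ}
    (hc : c ∈ nodes n β k)
    (h : JohnPath (treeSet i₀ β ρ) x₀ a s B (WithLp.toLp 2 c) (4 * n * β ^ k)) :
    JohnPath (treeSet i₀ β ρ) x₀ a s B (WithLp.toLp 2 (tubeCenter i₀ β c k σ))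
      (2 * n * β ^ k) := by
  have hr := P.pow_pos k
  have hn : (0 : ℝ) ≤ n := n.cast_nonneg
  refine P.johnPath_step ha hs hρ (P.johnPath_door (σ := σ) ha hs hρ hc h) ?_ (by positivity)
    (by linarith) ?_ ?_
  · have := mul_nonneg hn hr.le; linarith
  · intro i
    simp only [door, child, tubeCenter]
    rw [abs_le]
    split_ifs <;> rcases boolSign_cases (σ i) with h | h <;> try rw [h]
    all_goals constructor <;> linarith
  · intro θ hθ z hz
    refine tube_subset_treeDomain hc (mem_tube_of_near_axis P (φ := (1 - θ) / 2) (σ := σ)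
      ⟨by linarith [hθ.2], by linarith [hθ.1]⟩ ?_ fun i hi => ?_)
    · convert hz i₀ using 2
      simp only [door, tubeCenter, if_true]; ring
    · convert hz i using 2
      simp only [door, tubeCenter, child, if_neg hi]; ring

theorem TreeParams.johnPath_node (P : TreeParams β ρ) (ha : 0 ≤ a) (hs : 1 ≤ s)
    (hρ : ∀ k, a * (4 * n * β ^ k) ^ s ≤ ρ k) (hc : c ∈ nodes n β k) :
    JohnPath (treeSet i₀ β ρ) 0 a s (4 * n) (WithLp.toLp 2 c) (4 * n * β ^ k) := by
  induction k generalizing c with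
  | zero =>
    have : c = 0 := by simpa [nodes] using hc
    subst this
    have hball : Metric.ball (0 : EuclideanSpace ℝ (Fin n)) (ρ 0) ⊆ treeSet i₀ β ρ := by
      refine ball_subset_preimage fun z hz => room_subset_treeDomain hc fun i => ?_
      have hi := hz i
      have h1 := P.two_mul_thick_lt 0
      have h2 := P.thick_lt 0
      have h3 := P.thick_pos 0
      simp only [PiLp.zero_apply, sub_zero, Pi.zero_apply] at hi ⊢
      unfold roomWidth
      rw [pow_zero] at *
      split_ifs <;> linarith
    rw [WithLp.toLp_zero]
    exact JohnPath.refl (hball (Metric.mem_ball_self (P.thick_pos 0))) (by simp)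
      ((Metric.ball_subset_ball (hρ 0)).trans hball)
  | succ k ih =>
    obtain ⟨d, hd, σ, rfl⟩ := mem_nodes_succ.1 hc
    exact P.johnPath_child ha hs (hρ k) hd (ih hd)

theorem TreeParams.isJohnDomain (P : TreeParams β ρ) (ha : 0 < a) (hs : 1 ≤ s)
    (hρ : ∀ k, a * (4 * n * β ^ k) ^ s ≤ ρ k) : IsJohnDomain s (treeSet i₀ β ρ) := by
  have hn0 : 0 < n := i₀.pos
  have : NeZero n := ⟨hn0.ne'⟩
  have hn : (0 : ℝ) < n := by exact_mod_cast hn0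
  have hx₀ : (0 : EuclideanSpace ℝ (Fin n)) ∈ treeSet i₀ β ρ := by
    refine room_subset_treeDomain (k := 0) (c := 0) (by simp [nodes]) fun i => ?_
    have := P.margin_pos
    simp only [PiLp.zero_apply, Pi.zero_apply, sub_zero, abs_zero, roomWidth, pow_zero, mul_one]
    split_ifs <;> linarith
  refine isJohnDomain_of_johnPath hs ha (B := 4 * n) (by positivity) isOpen_treeSet
    (isBounded_treeSet P) hx₀ fun x hx => ?_
  obtain ⟨k, c, hc, h | ⟨σ, h⟩⟩ := mem_treeDomain_iff.1 hx
  · have hr := P.pow_pos k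
    have hk := P.two_mul_thick_lt k
    have hk' := P.thick_lt k
    have hm := TreeParams.margin_mul β k
    have hr' := P.pow_pos (k + 1)
    have := P.thick_pos k
    refine P.johnPath_axisBox ha.le hs (hρ k) (P.johnPath_node ha.le hs hρ hc) ?_
      (w := roomWidth i₀ β k) ?_ ?_ h (room_subset_treeDomain hc)
    · have := mul_pos hn hr; linarith
    · intro i; unfold roomWidth; split_ifs <;> linarith
    · intro i; unfold roomWidth; split_ifs <;> linarith
  · have hr := P.pow_pos k
    have hk' := P.thick_lt k
    have := P.thick_pos k
    refine P.johnPath_axisBox ha.le hs (hρ k) (P.johnPath_tubeCenter (σ := σ) ha.le hs (hρ k) hc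
      (P.johnPath_node ha.le hs hρ hc)) ?_ (w := tubeWidth i₀ β ρ k) ?_ ?_ h
      (tube_subset_treeDomain hc)
    · have := mul_pos hn hr; linarith
    · intro i; unfold tubeWidth; split_ifs <;> linarith
    · intro i; unfold tubeWidth; split_ifs <;> linarith

end John

end TreeSet

/-! ### Volume of neighbourhoods of the frontier -/

section MinkowskiVolume

variable {n : ℕ} {i₀ : Fin n} {β : ℝ} {ρ : ℕ → ℝ} {c : Fin n → ℝ} {k : ℕ} {σ : Fin n → Bool}

theorem volume_preimage_ofLp (S : Set (Fin n → ℝ)) :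
    volume (WithLp.ofLp ⁻¹' S : Set (EuclideanSpace ℝ (Fin n))) = volume S :=
  (EuclideanSpace.volume_preserving_symm_measurableEquiv_toLp (Fin n)).measure_preimage_equiv S

/-- From the centre of a child, a move in the direction `i₁` to one margin beyond its face leaves
both the child's subtree and, sideways, the tube leading to it. -/
theorem TreeParams.exists_notMem_treeDomain (P : TreeParams β ρ) {i₁ : Fin n} (hi : i₁ ≠ i₀)
    (hc : c ∈ nodes n β k) : ∃ y ∈ Metric.closedBall c (β ^ k), y ∉ treeDomain i₀ β ρ := by
  have hr := P.pow_pos k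
  have hr' := P.pow_pos (k + 1)
  have hm := mul_pos P.margin_pos hr
  set σ : Fin n → Bool := fun _ => true
  set R : ℝ := β ^ (k + 1) + margin β * β ^ k
  set y : Fin n → ℝ := fun i => child β c k σ i + if i = i₁ then R else 0
  have hy : y ∈ bigCube β c k σ := by
    rw [bigCube, mem_closedBall_pi (by positivity)]
    intro i
    simp only [y, add_sub_cancel_left]
    split_ifs
    · rw [abs_of_pos (by positivity)]; simp only [R]; linarith
    · rw [abs_zero]; positivity
  have hyi : |y i₁ - child β c k σ i₁| = R := by
    simp only [y, add_sub_cancel_left, if_true]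
    exact abs_of_pos (by positivity)
  refine ⟨y, bigCube_subset P hy, fun hyG => ?_⟩
  rcases inTree_or_mem_tube P hi hc hyG hy with h | h
  · have h1 := (mem_closedBall_pi hr'.le).1 (h.mem_closedBall P) i₁
    rw [hyi] at h1
    linarith
  · have h1 := h i₁
    unfold tubeWidth tubeCenter at h1
    rw [if_neg hi, if_neg hi, hyi] at h1
    have := P.two_mul_thick_lt k
    have := P.thick_pos k
    linarith

theorem TreeParams.exists_mem_frontier (P : TreeParams β ρ) {i₁ : Fin n} (hi : i₁ ≠ i₀)
    (hc : c ∈ nodes n β k) :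
    ∃ z ∈ frontier (treeSet i₀ β ρ), z.ofLp ∈ Metric.closedBall c (β ^ k) := by
  obtain ⟨y, hy, hyG⟩ := P.exists_notMem_treeDomain hi hc
  have hr := P.pow_pos k
  have hm := mul_pos P.margin_pos hr
  have hconv : Convex ℝ (WithLp.ofLp ⁻¹' Metric.closedBall c (β ^ k) :
      Set (EuclideanSpace ℝ (Fin n))) :=
    (convex_closedBall c (β ^ k)).linear_preimage
      (WithLp.linearEquiv 2 ℝ (Fin n → ℝ)).toLinearMap
  obtain ⟨z, hz, hzf⟩ := hconv.isPreconnected.exists_mem_frontier (G := treeSet i₀ β ρ)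
    (x := WithLp.toLp 2 c) (y := WithLp.toLp 2 y) (Metric.mem_closedBall_self hr.le)
    (room_subset_treeDomain hc fun i => by
      simp only [sub_self, abs_zero, roomWidth]; split_ifs <;> positivity) hy hyG
  exact ⟨z, hzf, hz⟩

theorem TreeParams.volume_cubes (P : TreeParams β ρ) (k : ℕ) :
    volume (cubes n β k) = ENNReal.ofReal ((2 ^ n * β ^ n) ^ k * 2 ^ n) := by
  rw [cubes, measure_biUnion_finset (pairwiseDisjoint_nodes P k)
    fun _ _ => measurableSet_closedBall]
  have : ∀ c ∈ nodes n β k, volume (Metric.closedBall c (β ^ k)) =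
      ENNReal.ofReal ((2 * β ^ k) ^ n) := by
    intro c _
    rw [Real.volume_pi_closedBall _ (P.pow_pos k).le, Fintype.card_fin]
  rw [Finset.sum_congr rfl this, Finset.sum_const, card_nodes P, nsmul_eq_mul,
    ← ENNReal.ofReal_natCast, ← ENNReal.ofReal_mul (by positivity)]
  congr 1
  push_cast
  rw [mul_pow, mul_pow, pow_right_comm β]
  ring

/-- The volume of the neighbourhoods of the frontier, from below. -/
theorem TreeParams.le_volume_nbhd (P : TreeParams β ρ) {i₁ : Fin n} (hi : i₁ ≠ i₀) (k : ℕ) :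
    ENNReal.ofReal ((2 ^ n * β ^ n) ^ k * 2 ^ n) ≤
      volume (⋃ x ∈ frontier (treeSet i₀ β ρ), Metric.ball x ((2 * n + 1) * β ^ k)) := by
  rw [← P.volume_cubes k, ← volume_preimage_ofLp]
  refine measure_mono fun y hy => ?_
  obtain ⟨c, hc, hyc⟩ := mem_iUnion₂.1 hy
  obtain ⟨z, hz, hzc⟩ := P.exists_mem_frontier hi hc
  have hr := P.pow_pos k
  refine mem_iUnion₂.2 ⟨z, hz, ?_⟩
  -- Two points of one cube differ by at most `2 * β ^ k` in each coordinate; the `+ 1` in the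
  -- radius makes the final inequality strict.
  have hd : dist y z ≤ n * (2 * β ^ k) := by
    refine dist_le_of_abs_apply_sub_le fun i => ?_
    have h1 := abs_le.1 ((mem_closedBall_pi hr.le).1 hyc i)
    have h2 := abs_le.1 ((mem_closedBall_pi hr.le).1 hzc i)
    rw [abs_le]
    constructor <;> linarith
  rw [Metric.mem_ball]
  linarith

/-- The points at sup distance less than `r` from the boundary of a box. -/
def boxShell (a h : Fin n → ℝ) (r : ℝ) : Set (Fin n → ℝ) :=
  {y | (∀ i, |y i - a i| < h i + r) ∧ ∃ i, h i - r < |y i - a i|}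

/-- The shell is covered by `2 * n` slabs, one for each face, of thickness `2 * r` and side `4 * R`.
-/
theorem volume_boxShell_le {a h : Fin n → ℝ} {r R : ℝ} (hr : 0 < r) (hrR : r ≤ R)
    (hR : ∀ i, h i ≤ R) :
    volume (boxShell a h r) ≤ ENNReal.ofReal (2 * n * (2 * r * (4 * R) ^ (n - 1))) := by
  have hbox : ∀ (b : ℝ) (i : Fin n), volume (axisBox (Function.update a i b)
      (Function.update (fun _ => 2 * R) i r)) = ENNReal.ofReal (2 * r * (4 * R) ^ (n - 1)) := by
    intro b i
    rw [volume_axisBox, ← ENNReal.ofReal_prod_of_nonneg]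
    · congr 1
      rw [← Finset.mul_prod_erase _ _ (Finset.mem_univ i), Function.update_self]
      congr 1
      rw [Finset.prod_congr rfl (g := fun _ => 4 * R)]
      · simp [Finset.card_erase_of_mem]
      · intro j hj
        rw [Function.update_of_ne (Finset.ne_of_mem_erase hj)]; ring
    · intro j _
      by_cases hj : j = i
      · subst hj; rw [Function.update_self]; positivity
      · rw [Function.update_of_ne hj]; linarith
  have hsub : boxShell a h r ⊆ ⋃ i ∈ (Finset.univ : Finset (Fin n)),
      (axisBox (Function.update a i (a i + h i)) (Function.update (fun _ => 2 * R) i r) ∪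
        axisBox (Function.update a i (a i - h i)) (Function.update (fun _ => 2 * R) i r)) := by
    rintro y ⟨hy, i, hi⟩
    refine mem_iUnion₂.2 ⟨i, Finset.mem_univ i, ?_⟩
    have hyi := hy i
    rcases le_total 0 (y i - a i) with h0 | h0
    · left
      intro j
      by_cases hj : j = i
      · subst hj
        rw [Function.update_self, Function.update_self]
        rw [abs_of_nonneg h0] at hi hyi
        rw [abs_lt]; constructor <;> linarith
      · rw [Function.update_of_ne hj, Function.update_of_ne hj]
        linarith [hy j, hR j]
    · right
      intro j
      by_cases hj : j = i
      · subst hj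
        rw [Function.update_self, Function.update_self]
        rw [abs_of_nonpos h0] at hi hyi
        rw [abs_lt]; constructor <;> linarith
      · rw [Function.update_of_ne hj, Function.update_of_ne hj]
        linarith [hy j, hR j]
  have hR0 : 0 < R := hr.trans_le hrR
  refine (measure_mono hsub).trans ((measure_biUnion_finset_le _ _).trans ?_)
  refine (Finset.sum_le_sum fun i _ => measure_union_le _ _).trans ?_
  simp only [hbox]
  generalize 2 * r * (4 * R) ^ (n - 1) = V
  rw [Finset.sum_const, Finset.card_univ, Fintype.card_fin, nsmul_eq_mul, ← two_mul, ← mul_assoc,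
    ENNReal.ofReal_mul (by positivity), ENNReal.ofReal_mul (by positivity)]
  simp [mul_comm]

theorem mem_boxShell {a h x x' y : Fin n → ℝ} {r : ℝ} (hx : x ∉ axisBox a h)
    (hx' : x' ∈ axisBox a h) (hyx : ∀ i, |y i - x i| < r) (hyx' : ∀ i, |y i - x' i| < r) :
    y ∈ boxShell a h r := by
  refine ⟨fun i => ?_, ?_⟩
  · have := hx' i
    have := hyx' i
    have := abs_sub_le (y i) (x' i) (a i)
    linarith
  · simp only [axisBox, mem_ofPred_eq, not_forall, not_lt] at hx
    obtain ⟨i, hi⟩ := hx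
    have := hyx i
    have := abs_sub_le (x i) (y i) (a i)
    rw [abs_sub_comm (x i) (y i)] at this
    exact ⟨i, by linarith⟩

/-- A frontier point `x` lies in no room or tube, but points `x'` of the domain lie arbitrarily
near. If `x'` is in a box of generation less than `k`, then `y` is within `r` of a point of that box
and of a point outside it, hence in its shell. -/
theorem TreeParams.nbhd_subset (P : TreeParams β ρ) (k : ℕ) (r : ℝ) :
    (⋃ x ∈ frontier (treeSet i₀ β ρ), Metric.ball x r) ⊆ WithLp.ofLp ⁻¹'
      ((⋃ c ∈ nodes n β k, Metric.closedBall c (β ^ k + r)) ∪ ⋃ j ∈ Finset.range k,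
        ⋃ d ∈ nodes n β j, (boxShell d (roomWidth i₀ β j) r ∪ ⋃ σ ∈ Finset.univ,
          boxShell (tubeCenter i₀ β d j σ) (tubeWidth i₀ β ρ j) r)) := by
  intro y hy
  obtain ⟨x, hx, hyx⟩ := mem_iUnion₂.1 hy
  rw [isOpen_treeSet.frontier_eq] at hx
  rw [Metric.mem_ball] at hyx
  obtain ⟨x', hx', hxx'⟩ := Metric.mem_closure_iff.1 hx.1 (r - dist y x) (by linarith)
  have hyx' : dist y x' < r := by linarith [dist_triangle y x x']
  have h1 : ∀ i, |y i - x i| < r := fun i => (abs_apply_sub_le_dist y x i).trans_lt hyx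
  have h2 : ∀ i, |y i - x' i| < r := fun i => (abs_apply_sub_le_dist y x' i).trans_lt hyx'
  rcases mem_cubes_or_exists P hx' k with h | ⟨j, hj, d, hd, h⟩
  · left
    obtain ⟨c, hc, hxc⟩ := mem_iUnion₂.1 h
    refine mem_iUnion₂.2 ⟨c, hc, ?_⟩
    rw [Metric.mem_closedBall] at hxc ⊢
    have := dist_ofLp_le y x'
    linarith [dist_triangle y.ofLp x'.ofLp c]
  · right
    refine mem_iUnion₂.2 ⟨j, Finset.mem_range.2 hj, mem_iUnion₂.2 ⟨d, hd, ?_⟩⟩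
    rcases h with h | ⟨σ, h⟩
    · exact Or.inl (mem_boxShell (fun hxr => hx.2 (room_subset_treeDomain hd hxr)) h h1 h2)
    · exact Or.inr (mem_iUnion₂.2 ⟨σ, Finset.mem_univ σ,
        mem_boxShell (fun hxr => hx.2 (tube_subset_treeDomain hd hxr)) h h1 h2⟩)

theorem TreeParams.roomWidth_le (P : TreeParams β ρ) (k : ℕ) (i : Fin n) :
    roomWidth i₀ β k i ≤ β ^ k := by
  have hr := P.pow_pos k
  have hr' := P.pow_pos (k + 1)
  have hm := TreeParams.margin_mul β k
  unfold roomWidth; split_ifs <;> linarith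

theorem TreeParams.tubeWidth_le (P : TreeParams β ρ) (k : ℕ) (i : Fin n) :
    tubeWidth i₀ β ρ k i ≤ β ^ k := by
  have hr := P.pow_pos k
  have hk := P.thick_lt k
  unfold tubeWidth; split_ifs <;> linarith

/-- The volume of the neighbourhoods of the frontier, from above. -/
theorem TreeParams.volume_nbhd_le (P : TreeParams β ρ) (hβ : 1 ≤ 2 ^ n * β ^ (n - 1)) {r : ℝ}
    (hr : 0 < r) (hrk : r ≤ β ^ k) :
    volume (⋃ x ∈ frontier (treeSet i₀ β ρ), Metric.ball x r) ≤
      ENNReal.ofReal ((1 + (1 + 2 ^ n) * (n + 1)) * 4 ^ n * ((k + 1) * (2 ^ n * β ^ n) ^ k)) := by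
  have hn : 0 < n := i₀.pos
  have hβ0 := P.pos
  have hrk' := P.pow_pos k
  set S : ℕ → ℝ := fun j => 2 * n * (2 * r * (4 * β ^ j) ^ (n - 1)) with hS
  have hS0 : ∀ j, 0 ≤ S j := fun j => by have := P.pow_pos j; positivity
  have hcubes : volume (⋃ c ∈ nodes n β k, Metric.closedBall c (β ^ k + r)) ≤
      ENNReal.ofReal (4 ^ n * (2 ^ n * β ^ n) ^ k) := by
    refine (measure_biUnion_finset_le _ _).trans ?_
    have : ∀ c ∈ nodes n β k, volume (Metric.closedBall c (β ^ k + r)) ≤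
        ENNReal.ofReal ((4 * β ^ k) ^ n) := by
      intro c _
      rw [Real.volume_pi_closedBall _ (by positivity), Fintype.card_fin]
      exact ENNReal.ofReal_le_ofReal (pow_le_pow_left₀ (by positivity) (by linarith) _)
    refine (Finset.sum_le_sum this).trans (le_of_eq ?_)
    rw [Finset.sum_const, card_nodes P, nsmul_eq_mul, ← ENNReal.ofReal_natCast,
      ← ENNReal.ofReal_mul (by positivity)]
    congr 1
    push_cast
    rw [mul_pow, mul_pow, pow_right_comm β]
    ring
  have hlevel : ∀ j ∈ Finset.range k, volume (⋃ d ∈ nodes n β j,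
      (boxShell d (roomWidth i₀ β j) r ∪ ⋃ σ ∈ Finset.univ,
        boxShell (tubeCenter i₀ β d j σ) (tubeWidth i₀ β ρ j) r)) ≤
      ENNReal.ofReal ((2 ^ n) ^ j * ((1 + 2 ^ n) * S j)) := by
    intro j hj
    have hrj : r ≤ β ^ j := hrk.trans (pow_le_pow_of_le_one hβ0.le (by linarith [P.lt_half])
      (Finset.mem_range.1 hj).le)
    refine (measure_biUnion_finset_le _ _).trans ?_
    have : ∀ d ∈ nodes n β j, volume (boxShell d (roomWidth i₀ β j) r ∪ ⋃ σ ∈ Finset.univ,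
        boxShell (tubeCenter i₀ β d j σ) (tubeWidth i₀ β ρ j) r) ≤
        ENNReal.ofReal ((1 + 2 ^ n) * S j) := by
      intro d _
      refine (measure_union_le _ _).trans ?_
      refine (add_le_add (volume_boxShell_le hr hrj (P.roomWidth_le j))
        ((measure_biUnion_finset_le _ _).trans (Finset.sum_le_sum fun σ _ =>
          volume_boxShell_le hr hrj (P.tubeWidth_le j)))).trans (le_of_eq ?_)
      rw [Finset.sum_const, Finset.card_univ, nsmul_eq_mul, ← ENNReal.ofReal_natCast,
        ← ENNReal.ofReal_mul (by positivity), ← ENNReal.ofReal_add (hS0 j)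
        (mul_nonneg (by positivity) (hS0 j))]
      congr 1
      simp only [Fintype.card_fun, Fintype.card_bool, Fintype.card_fin, hS]
      push_cast
      ring
    refine (Finset.sum_le_sum this).trans (le_of_eq ?_)
    rw [Finset.sum_const, card_nodes P, nsmul_eq_mul, ← ENNReal.ofReal_natCast,
      ← ENNReal.ofReal_mul (by positivity)]
    push_cast
    rfl
  refine (measure_mono (P.nbhd_subset k r)).trans ?_
  rw [volume_preimage_ofLp]
  refine (measure_union_le _ _).trans ((add_le_add hcubes ((measure_biUnion_finset_le _ _).trans
    (Finset.sum_le_sum hlevel))).trans ?_)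
  rw [← ENNReal.ofReal_sum_of_nonneg fun j _ => by have := hS0 j; positivity,
    ← ENNReal.ofReal_add (by positivity)
      (Finset.sum_nonneg fun j _ => by have := hS0 j; positivity)]
  refine ENNReal.ofReal_le_ofReal ?_
  have hq : 0 < 2 ^ n * β ^ n := by positivity
  -- By `hβ` the bounds for the wall contributions are nondecreasing in `j`, so each is dominated by
  -- the order of the cubes of generation `k`; the sum costs a factor `k`.
  have hterm : ∀ j ∈ Finset.range k, (2 ^ n) ^ j * ((1 + 2 ^ n) * S j) ≤
      (1 + 2 ^ n) * n * 4 ^ n * (2 ^ n * β ^ n) ^ k := by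
    intro j hj
    have h1 : (2 ^ n) ^ j * ((1 + 2 ^ n) * S j) =
        (1 + 2 ^ n) * n * (4 * 4 ^ (n - 1)) * ((2 ^ n * β ^ (n - 1)) ^ j * r) := by
      simp only [hS]
      rw [mul_pow, mul_pow, pow_right_comm β]
      ring
    have h4 : (4 : ℝ) * 4 ^ (n - 1) = 4 ^ n := mul_pow_sub_one hn.ne' _
    have h2 : (2 ^ n * β ^ (n - 1)) ^ j * r ≤ (2 ^ n * β ^ n) ^ k := by
      calc (2 ^ n * β ^ (n - 1)) ^ j * r ≤ (2 ^ n * β ^ (n - 1)) ^ k * β ^ k :=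
            mul_le_mul (pow_le_pow_right₀ hβ (Finset.mem_range.1 hj).le) hrk hr.le (by positivity)
        _ = (2 ^ n * β ^ n) ^ k := by
            rw [← mul_pow, mul_assoc, pow_sub_one_mul hn.ne']
    rw [h1, h4]
    exact mul_le_mul_of_nonneg_left h2 (by positivity)
  have hsum := Finset.sum_le_sum hterm
  rw [Finset.sum_const, Finset.card_range, nsmul_eq_mul] at hsum
  have hqk : 0 < 4 ^ n * (2 ^ n * β ^ n) ^ k := by positivity
  have hk0 : (0 : ℝ) ≤ k := k.cast_nonneg
  have hn0 : (0 : ℝ) ≤ n := n.cast_nonneg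
  have h2n : (0 : ℝ) < 2 ^ n := by positivity
  calc _ ≤ 4 ^ n * (2 ^ n * β ^ n) ^ k +
        k * ((1 + 2 ^ n) * n * 4 ^ n * (2 ^ n * β ^ n) ^ k) := by linarith
    _ = (1 + k * ((1 + 2 ^ n) * n)) * (4 ^ n * (2 ^ n * β ^ n) ^ k) := by ring
    _ ≤ ((1 + (1 + 2 ^ n) * (n + 1)) * (k + 1)) * (4 ^ n * (2 ^ n * β ^ n) ^ k) := by
        refine mul_le_mul_of_nonneg_right ?_ hqk.le
        have h1 : 0 ≤ (1 + (2 : ℝ) ^ n) * (k + 1) := by positivity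
        have h2 : 0 ≤ (1 + (2 : ℝ) ^ n) * n := by positivity
        linarith
    _ = _ := by ring

end MinkowskiVolume

/-! ### The upper Minkowski dimension of the frontier -/

section MinkowskiDim

variable {n : ℕ} {i₀ : Fin n} {β : ℝ} {ρ : ℕ → ℝ} {lam : ℝ}

theorem TreeParams.two_pow_mul (P : TreeParams β ρ) (hlam : (2 : ℝ) ^ n = β ^ (-lam)) :
    (2 : ℝ) ^ n * β ^ n = β ^ ((n : ℝ) - lam) := by
  rw [hlam, ← Real.rpow_natCast β n, ← Real.rpow_add P.pos]
  congr 1; ring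

theorem exists_bound_mul_pow {θ : ℝ} (h0 : 0 ≤ θ) (h1 : θ < 1) :
    ∃ C : ℝ, ∀ k : ℕ, ((k : ℝ) + 1) * θ ^ k ≤ C := by
  have h := (tendsto_self_mul_const_pow_of_lt_one h0 h1).add
    (tendsto_pow_atTop_nhds_zero_of_lt_one h0 h1)
  obtain ⟨C, hC⟩ := h.bddAbove_range
  exact ⟨C, fun k => by have := hC ⟨k, rfl⟩; simpa [add_mul] using this⟩

theorem TreeParams.limsup_precontent_lt_top (P : TreeParams β ρ)
    (hlam : (2 : ℝ) ^ n = β ^ (-lam)) (hlam1 : (n : ℝ) - 1 ≤ lam) {d : ℝ} (hd : lam < d) :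
    limsup (fun r : ℝ => minkowskiPrecontent d (frontier (treeSet i₀ β ρ)) r) (𝓝[>] 0) ≠ ⊤ := by
  have hn : 0 < n := i₀.pos
  have hβ0 := P.pos
  have hβ1 : β < 1 := by linarith [P.lt_half]
  have hβ : 1 ≤ 2 ^ n * β ^ (n - 1) := by
    have h1 : ((n - 1 : ℕ) : ℝ) = (n : ℝ) - 1 := by rw [Nat.cast_sub hn]; simp
    rw [hlam, ← Real.rpow_natCast, ← Real.rpow_add hβ0, h1]
    exact Real.one_le_rpow_of_pos_of_le_one_of_nonpos hβ0 hβ1.le (by linarith)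
  set A : ℝ := (1 + (1 + 2 ^ n) * (n + 1)) * 4 ^ n with hA
  have hA0 : 0 < A := by positivity
  -- The decay of `(β ^ (d - lam)) ^ k` absorbs the factor `k + 1` of the volume bound.
  obtain ⟨C, hC⟩ := exists_bound_mul_pow (Real.rpow_nonneg hβ0.le (d - lam))
    (Real.rpow_lt_one hβ0.le hβ1 (by linarith))
  set e : ℝ := (n : ℝ) - d with he
  -- The exponent `e` is negative when `d > n`; with the absolute value, `m` bounds `(r / β ^ k) ^
  -- e` from below for either sign.
  set m : ℝ := β ^ |e| with hm
  have hm0 : 0 < m := Real.rpow_pos_of_pos hβ0 _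
  suffices h : ∀ᶠ r in 𝓝[>] (0 : ℝ), minkowskiPrecontent d (frontier (treeSet i₀ β ρ)) r ≤
      ENNReal.ofReal (A * C / m) from
    ((limsup_le_of_le (by isBoundedDefault) h).trans_lt ENNReal.ofReal_lt_top).ne
  filter_upwards [Ioc_mem_nhdsGT zero_lt_one] with r hr
  obtain ⟨k, hk1, hk2⟩ := exists_nat_pow_near_of_lt_one hr.1 hr.2 hβ0 hβ1
  unfold minkowskiPrecontent
  have hr0 := hr.1
  have hre : 0 < r ^ e := Real.rpow_pos_of_pos hr0 _
  have hk := P.pow_pos k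
  refine ENNReal.div_le_of_le_mul ?_
  rw [← he, ← ENNReal.ofReal_mul' hre.le]
  refine (P.volume_nbhd_le hβ hr.1 hk2).trans (ENNReal.ofReal_le_ofReal ?_)
  rw [P.two_pow_mul hlam, ← hA]
  have hlow : m * (β ^ e) ^ k ≤ r ^ e := by
    have h1 : r ^ e = (r / β ^ k) ^ e * (β ^ e) ^ k := by
      rw [← Real.rpow_natCast (β ^ e), ← Real.rpow_mul hβ0.le, mul_comm e, Real.rpow_mul hβ0.le,
        Real.rpow_natCast, ← Real.mul_rpow (by positivity) hk.le, div_mul_cancel₀ _ hk.ne']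
    rw [h1]
    refine mul_le_mul_of_nonneg_right ?_ (by positivity)
    have hx : β ≤ r / β ^ k := by
      rw [le_div_iff₀ hk, mul_comm, ← pow_succ]; exact hk1.le
    have hx0 : 0 < r / β ^ k := by positivity
    calc m ≤ (r / β ^ k) ^ |e| := Real.rpow_le_rpow hβ0.le hx (abs_nonneg e)
      _ ≤ (r / β ^ k) ^ e := Real.rpow_le_rpow_of_exponent_ge hx0 ((div_le_one hk).2 hk2)
          (le_abs_self e)
  have hsplit : (β ^ ((n : ℝ) - lam)) ^ k = (β ^ (d - lam)) ^ k * (β ^ e) ^ k := by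
    rw [← mul_pow, ← Real.rpow_add hβ0]; congr 2; rw [he]; ring
  have hC0 : 0 ≤ C := by
    refine le_trans ?_ (hC 0); simp
  rw [hsplit]
  calc A * (((k : ℝ) + 1) * ((β ^ (d - lam)) ^ k * (β ^ e) ^ k))
      = A * ((((k : ℝ) + 1) * (β ^ (d - lam)) ^ k) * (β ^ e) ^ k) := by ring
    _ ≤ A * (C * (β ^ e) ^ k) := by
        refine mul_le_mul_of_nonneg_left (mul_le_mul_of_nonneg_right (hC k) ?_) hA0.le
        positivity
    _ = A * C / m * (m * (β ^ e) ^ k) := by field_simp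
    _ ≤ A * C / m * r ^ e := mul_le_mul_of_nonneg_left hlow (by positivity)

/-- Along the radii `(2 * n + 1) * β ^ k`, the precontent is at least a constant times `(β ^ (d -
lam)) ^ k`, which diverges. -/
theorem TreeParams.limsup_precontent_eq_top (P : TreeParams β ρ) {i₁ : Fin n} (hi : i₁ ≠ i₀)
    (hlam : (2 : ℝ) ^ n = β ^ (-lam)) {d : ℝ} (hd : d < lam) :
    limsup (fun r : ℝ => minkowskiPrecontent d (frontier (treeSet i₀ β ρ)) r) (𝓝[>] 0) = ⊤ := by
  have hβ0 := P.pos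
  have hβ1 : β < 1 := by linarith [P.lt_half]
  set e : ℝ := (n : ℝ) - d with he
  set D : ℝ := 2 * n + 1 with hD
  have hD0 : 0 < D := by positivity
  have hDe : 0 < D ^ e := Real.rpow_pos_of_pos hD0 _
  have hrad : Tendsto (fun k : ℕ => D * β ^ k) atTop (𝓝[>] 0) := by
    refine tendsto_nhdsWithin_iff.2 ⟨?_, Eventually.of_forall fun k => ?_⟩
    · simpa using (tendsto_pow_atTop_nhds_zero_of_lt_one hβ0.le hβ1).const_mul D
    · have := P.pow_pos k
      exact mem_Ioi.2 (by positivity)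
  have hθ : 1 < β ^ (d - lam) :=
    Real.one_lt_rpow_of_pos_of_lt_one_of_neg hβ0 hβ1 (by linarith)
  have hbound : ∀ k : ℕ, ENNReal.ofReal (2 ^ n / D ^ e * (β ^ (d - lam)) ^ k) ≤
      minkowskiPrecontent d (frontier (treeSet i₀ β ρ)) (D * β ^ k) := by
    intro k
    have hk := P.pow_pos k
    have hre : 0 < (D * β ^ k) ^ e := Real.rpow_pos_of_pos (by positivity) _
    unfold minkowskiPrecontent
    rw [ENNReal.le_div_iff_mul_le (Or.inl (by rw [← he]; simpa using hre))
      (Or.inl ENNReal.ofReal_ne_top), ← he, ← ENNReal.ofReal_mul' hre.le]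
    refine le_trans (le_of_eq ?_) (P.le_volume_nbhd hi k)
    congr 1
    have h1 : (β ^ k) ^ e = (β ^ e) ^ k := by
      rw [← Real.rpow_natCast (β ^ e), ← Real.rpow_mul hβ0.le, mul_comm e, Real.rpow_mul hβ0.le,
        Real.rpow_natCast]
    have h2 : β ^ (d - lam) * β ^ e = β ^ ((n : ℝ) - lam) := by
      rw [← Real.rpow_add hβ0]; congr 1; rw [he]; ring
    rw [P.two_pow_mul hlam, Real.mul_rpow hD0.le hk.le, h1, ← h2, mul_pow]
    field_simp
  have htend : Tendsto (fun k : ℕ => ENNReal.ofReal (2 ^ n / D ^ e * (β ^ (d - lam)) ^ k)) atTop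
      (𝓝 ⊤) :=
    ENNReal.tendsto_ofReal_atTop.comp
      ((tendsto_pow_atTop_atTop_of_one_lt hθ).const_mul_atTop (by positivity))
  have h2 : Tendsto (fun k : ℕ => minkowskiPrecontent d (frontier (treeSet i₀ β ρ)) (D * β ^ k))
      atTop (𝓝 ⊤) := tendsto_of_tendsto_of_tendsto_of_le_of_le htend tendsto_const_nhds hbound
        fun _ => le_top
  refine top_le_iff.1 ?_
  calc (⊤ : ℝ≥0∞) = limsup (fun k : ℕ =>
        minkowskiPrecontent d (frontier (treeSet i₀ β ρ)) (D * β ^ k)) atTop :=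
        h2.limsup_eq.symm
    _ = limsup (fun r : ℝ => minkowskiPrecontent d (frontier (treeSet i₀ β ρ)) r)
        (map (fun k : ℕ => D * β ^ k) atTop) := rfl
    _ ≤ _ := limsup_le_limsup_of_le hrad

theorem TreeParams.upperMinkowskiDim_frontier (P : TreeParams β ρ) {i₁ : Fin n} (hi : i₁ ≠ i₀)
    (hlam : (2 : ℝ) ^ n = β ^ (-lam)) (hlam1 : (n : ℝ) - 1 ≤ lam) :
    upperMinkowskiDim (frontier (treeSet i₀ β ρ)) = ENNReal.ofReal lam := by
  unfold upperMinkowskiDim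
  apply le_antisymm
  · refine iSup₂_le fun d hd => ?_
    by_contra hcon
    push Not at hcon
    have : lam < d := by
      rw [← ENNReal.ofReal_coe_nnreal] at hcon
      exact lt_of_not_ge fun h => hcon.not_ge (ENNReal.ofReal_le_ofReal h)
    exact P.limsup_precontent_lt_top hlam hlam1 this hd
  · refine le_of_forall_lt_imp_le_of_dense fun d hd => ?_
    lift d to ℝ≥0 using hd.ne_top
    refine le_iSup₂_of_le d (P.limsup_precontent_eq_top hi hlam ?_) le_rfl
    rw [← ENNReal.ofReal_coe_nnreal] at hd
    exact (ENNReal.ofReal_lt_ofReal_iff_of_nonneg d.coe_nonneg).1 hd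

end MinkowskiDim

/-! ### Integrals of powers of the distance over balls -/

section Kernel

theorem integral_ball_norm_rpow {n : ℕ} (hn : 0 < n) {α R : ℝ} (hα : 0 < α) (hR : 0 < R) :
    ∫ z in Metric.ball (0 : EuclideanSpace ℝ (Fin n)) R, ‖z‖ ^ (α - n) =
      n * volume.real (Metric.ball (0 : EuclideanSpace ℝ (Fin n)) 1) / α * R ^ α := by
  have : Nonempty (Fin n) := ⟨⟨0, hn⟩⟩
  have h1 : ∫ z in Metric.ball (0 : EuclideanSpace ℝ (Fin n)) R, ‖z‖ ^ (α - n) =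
      ∫ z : EuclideanSpace ℝ (Fin n), (Iio R).indicator (fun y : ℝ => y ^ (α - n)) ‖z‖ := by
    rw [← integral_indicator Metric.isOpen_ball.measurableSet]
    congr 1 with z
    simp [indicator]
  rw [h1, integral_fun_norm_addHaar, finrank_euclideanSpace, Fintype.card_fin]
  have h2 : ∫ y in Ioi (0 : ℝ), y ^ (n - 1) • (Iio R).indicator (fun y : ℝ => y ^ (α - n)) y =
      ∫ y in (0 : ℝ)..R, y ^ (α - 1) := by
    have : ∀ y : ℝ, y ^ (n - 1) • (Iio R).indicator (fun y : ℝ => y ^ (α - n)) y =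
        (Iio R).indicator (fun y : ℝ => y ^ (n - 1) * y ^ (α - n)) y := by
      intro y; simp [indicator]
    simp only [this]
    rw [setIntegral_indicator measurableSet_Iio, Ioi_inter_Iio,
      intervalIntegral.integral_of_le hR.le, integral_Ioc_eq_integral_Ioo]
    refine setIntegral_congr_fun measurableSet_Ioo fun y hy => ?_
    rw [← Real.rpow_natCast, ← Real.rpow_add hy.1, Nat.cast_sub hn]
    congr 1
    push_cast
    ring
  rw [h2, integral_rpow (Or.inl (by linarith)), sub_add_cancel, Real.zero_rpow hα.ne', sub_zero]
  simp only [nsmul_eq_mul, smul_eq_mul]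
  ring

theorem lintegral_ball_norm_sub_rpow {n : ℕ} (hn : 0 < n) {α R : ℝ} (hα : 0 < α) (hR : 0 < R)
    (x : EuclideanSpace ℝ (Fin n)) :
    ∫⁻ y in Metric.ball x R, ENNReal.ofReal (‖x - y‖ ^ (α - n)) =
      ENNReal.ofReal (n * volume.real (Metric.ball (0 : EuclideanSpace ℝ (Fin n)) 1) / α
        * R ^ α) := by
  have hint : IntegrableOn (fun z : EuclideanSpace ℝ (Fin n) => ‖z‖ ^ (α - n))
      (Metric.ball 0 R) := by
    refine integrableOn_ball_of_norm_le_rpow (C := 1) (α := n - α) ?_ ?_ ?_ ?_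
    · simpa using Nat.one_le_iff_ne_zero.2 hn.ne'
    · simpa using hα
    · refine Eventually.of_forall fun z => ?_
      rw [Real.norm_of_nonneg (Real.rpow_nonneg (norm_nonneg z) _), one_mul, neg_sub]
    · exact (measurable_norm.pow_const _).aestronglyMeasurable
  rw [← integral_ball_norm_rpow hn hα hR, ofReal_integral_eq_lintegral_ofReal hint
    (Eventually.of_forall fun z => Real.rpow_nonneg (norm_nonneg z) _),
    ← lintegral_indicator Metric.isOpen_ball.measurableSet,
    ← lintegral_indicator Metric.isOpen_ball.measurableSet,
    ← lintegral_sub_left_eq_self _ x]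
  congr 1 with y
  have : x - y ∈ Metric.ball x R ↔ y ∈ Metric.ball (0 : EuclideanSpace ℝ (Fin n)) R := by
    rw [Metric.mem_ball, mem_ball_zero_iff, dist_comm, dist_eq_norm, sub_sub_cancel]
  by_cases hy : y ∈ Metric.ball (0 : EuclideanSpace ℝ (Fin n)) R
  · rw [indicator_of_mem hy, indicator_of_mem (this.2 hy), sub_sub_cancel]
  · rw [indicator_of_notMem hy, indicator_of_notMem (mt this.1 hy)]

end Kernel

/-! ### Cut-off functions that vary only in the tubes -/

section Ramp

variable {n : ℕ} {i₀ : Fin n} {β : ℝ} {ρ : ℕ → ℝ} {τ : ℝ} {j : ℕ}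

/-- A cut-off function equal to one near the cubes of generation `j + 1` and vanishing away
from them. -/
noncomputable def ramp (β : ℝ) (j : ℕ) (x : EuclideanSpace ℝ (Fin n)) : ℝ :=
  max 0 (min 1 ((β ^ (j + 1) + 2 * (margin β * β ^ j) -
    Metric.infDist x.ofLp (nodes n β (j + 1) : Set (Fin n → ℝ))) / (margin β * β ^ j)))

theorem ramp_nonneg (x : EuclideanSpace ℝ (Fin n)) : 0 ≤ ramp β j x := le_max_left _ _

theorem ramp_le_one (x : EuclideanSpace ℝ (Fin n)) : ramp β j x ≤ 1 :=
  max_le zero_le_one (min_le_left _ _)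

theorem nodes_nonempty (j : ℕ) : (nodes n β j).Nonempty := by
  induction j with
  | zero => exact ⟨0, by simp [nodes]⟩
  | succ j ih =>
    obtain ⟨c, hc⟩ := ih
    exact ⟨_, child_mem_nodes hc fun _ => true⟩

theorem continuous_ramp : Continuous (ramp β j : EuclideanSpace ℝ (Fin n) → ℝ) := by
  unfold ramp
  have := (Metric.continuous_infDist_pt (nodes n β (j + 1) : Set (Fin n → ℝ))).comp
    (PiLp.continuous_ofLp 2 (fun _ : Fin n => ℝ))
  exact continuous_const.max (continuous_const.min ((continuous_const.sub this).div_const _))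

theorem TreeParams.abs_ramp_sub_le (P : TreeParams β ρ) (x y : EuclideanSpace ℝ (Fin n)) :
    |ramp β j x - ramp β j y| ≤ ‖x - y‖ / (margin β * β ^ j) := by
  have hm := mul_pos P.margin_pos (P.pow_pos j)
  unfold ramp
  refine (abs_max_sub_max_le_max _ _ _ _).trans (max_le (by simp; positivity) ?_)
  refine (abs_min_sub_min_le_max _ _ _ _).trans (max_le (by simp; positivity) ?_)
  rw [← sub_div, abs_div, abs_of_pos hm, sub_sub_sub_cancel_left]
  refine div_le_div_of_nonneg_right ?_ hm.le
  have h := (Metric.lipschitz_infDist_pt (nodes n β (j + 1) : Set (Fin n → ℝ))).dist_le_mul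
    y.ofLp x.ofLp
  rw [NNReal.coe_one, one_mul, Real.dist_eq] at h
  rw [← dist_eq_norm, dist_comm x y]
  exact h.trans (dist_ofLp_le y x)

theorem TreeParams.exists_of_ramp_ne_zero (P : TreeParams β ρ) {x : EuclideanSpace ℝ (Fin n)}
    (hx : ramp β j x ≠ 0) : ∃ c ∈ nodes n β j, ∃ σ,
      dist x.ofLp (child β c j σ) < β ^ (j + 1) + 2 * (margin β * β ^ j) := by
  have hm := mul_pos P.margin_pos (P.pow_pos j)
  have h : Metric.infDist x.ofLp (nodes n β (j + 1) : Set (Fin n → ℝ)) <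
      β ^ (j + 1) + 2 * (margin β * β ^ j) := by
    by_contra hcon
    push Not at hcon
    exact hx (max_eq_left ((min_le_right _ _).trans
      (div_nonpos_of_nonpos_of_nonneg (by linarith) hm.le)))
  obtain ⟨d, hd, hxd⟩ := (Metric.infDist_lt_iff
    (Finset.coe_nonempty.2 (nodes_nonempty (j + 1)))).1 h
  obtain ⟨c, hc, σ, rfl⟩ := mem_nodes_succ.1 (Finset.mem_coe.1 hd)
  exact ⟨c, hc, σ, hxd⟩

theorem TreeParams.ramp_eq_one (P : TreeParams β ρ) {x : EuclideanSpace ℝ (Fin n)}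
    {d : Fin n → ℝ} (hd : d ∈ nodes n β (j + 1))
    (h : dist x.ofLp d ≤ β ^ (j + 1) + margin β * β ^ j) : ramp β j x = 1 := by
  have hm := mul_pos P.margin_pos (P.pow_pos j)
  have h1 : Metric.infDist x.ofLp (nodes n β (j + 1) : Set (Fin n → ℝ)) ≤ _ :=
    (Metric.infDist_le_dist_of_mem (Finset.mem_coe.2 hd)).trans h
  unfold ramp
  rw [min_eq_left, max_eq_right zero_le_one]
  rw [le_div_iff₀ hm]
  linarith

/-- Between one and two margins from a child cube the domain is just the tube. If the distance
exceeded `ρ j`, shifts of `z` by `±t` along `i₁` with `ρ j < t < 2 * ρ j` would both remain in the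
tube, whose width `2 * ρ j` is too small; `t < 2 * ρ j` keeps the shifted points within one margin
of `z`. -/
theorem TreeParams.infDist_frontier_le (P : TreeParams β ρ) {i₁ : Fin n} (hi : i₁ ≠ i₀)
    {z : EuclideanSpace ℝ (Fin n)} (hz : z ∈ treeSet i₀ β ρ) {c : Fin n → ℝ}
    (hc : c ∈ nodes n β j) {σ : Fin n → Bool}
    (h1 : dist z.ofLp (child β c j σ) < β ^ (j + 1) + 2 * (margin β * β ^ j))
    (h2 : β ^ (j + 1) + margin β * β ^ j < dist z.ofLp (child β c j σ)) :
    Metric.infDist z (frontier (treeSet i₀ β ρ)) ≤ ρ j := by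
  by_contra! hcon
  have hρ := P.thick_pos j
  have hρ2 := P.two_mul_thick_lt j
  obtain ⟨t, ht1, ht2⟩ := exists_between (lt_min hcon (by linarith : ρ j < 2 * ρ j))
  have ht3 := ht2.trans_le (min_le_left _ _)
  have ht4 := ht2.trans_le (min_le_right _ _)
  have key : ∀ r : ℝ, |r| = t → |z i₁ + r - child β c j σ i₁| < ρ j := by
    intro r hr
    set w : EuclideanSpace ℝ (Fin n) := z + EuclideanSpace.single i₁ r with hw
    have hwz : dist w z = t := by
      rw [dist_eq_norm, hw, add_sub_cancel_left, PiLp.norm_single, Real.norm_eq_abs, hr]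
    have hwG : w ∈ treeSet i₀ β ρ :=
      ball_infDist_frontier_subset hz (by rw [Metric.mem_ball, hwz]; exact ht3)
    have hwz' := dist_ofLp_le w z
    rw [hwz] at hwz'
    have h3 : w.ofLp ∈ bigCube β c j σ := by
      rw [bigCube, Metric.mem_closedBall]
      linarith [dist_triangle w.ofLp z.ofLp (child β c j σ)]
    rcases inTree_or_mem_tube P hi hc hwG h3 with h | h
    · have h4 := Metric.mem_closedBall.1 (h.mem_closedBall P)
      have := dist_triangle z.ofLp w.ofLp (child β c j σ)
      rw [dist_comm z.ofLp w.ofLp] at this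
      linarith
    · have h4 := h i₁
      unfold tubeWidth tubeCenter at h4
      rw [if_neg hi, if_neg hi] at h4
      simpa [hw] using h4
  have ht0 : 0 < t := hρ.trans ht1
  have k1 := abs_lt.1 (key t (abs_of_pos ht0))
  have k2 := abs_lt.1 (key (-t) (by rw [abs_neg, abs_of_pos ht0]))
  linarith [k1.2, k2.1]

theorem IsPreconnected.exists_mem_Ioo {X : Type*} [TopologicalSpace X] {S : Set X}
    (hS : IsPreconnected S) {f : X → ℝ} (hf : ContinuousOn f S) {x y : X} (hx : x ∈ S)
    (hy : y ∈ S) (h : f x < f y) : ∃ z ∈ S, f z ∈ Ioo (f x) (f y) := by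
  obtain ⟨z, hz, hfz⟩ := hS.intermediate_value hx hy hf
    (⟨by linarith, by linarith⟩ : (f x + f y) / 2 ∈ Icc (f x) (f y))
  exact ⟨z, hz, by rw [hfz]; constructor <;> linarith⟩

/-- On the segment from `x` to `y` some `z` has a ramp value strictly between 0 and 1, so `z` is in
a thin part of a tube. The distance to the frontier is 1-Lipschitz and `dist z x` is less than `τ`
times its value at `x`, which yields the factor `1 / (1 - τ)`; the bound `hρ` then keeps `x` within
one margin of `z`. -/
theorem TreeParams.of_ramp_ne (P : TreeParams β ρ) {i₁ : Fin n} (hi : i₁ ≠ i₀)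
    (hτ : τ ∈ Ioo (0 : ℝ) 1) (hρ : ρ j ≤ margin β * β ^ j * (1 - τ))
    {x y : EuclideanSpace ℝ (Fin n)} (hx : x ∈ treeSet i₀ β ρ)
    (hy : y ∈ Metric.ball x (τ * Metric.infDist x (frontier (treeSet i₀ β ρ))))
    (hne : ramp β j x ≠ ramp β j y) :
    Metric.infDist x (frontier (treeSet i₀ β ρ)) ≤ ρ j / (1 - τ) ∧ x.ofLp ∉ cubes n β (j + 1) ∧
      ∃ c ∈ nodes n β j, ∃ σ, x.ofLp ∈ tube i₀ β ρ c j σ := by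
  set d := Metric.infDist x (frontier (treeSet i₀ β ρ)) with hd
  have hτ1 : 0 < 1 - τ := by linarith [hτ.2]
  have hd0 : 0 ≤ d := Metric.infDist_nonneg
  have hpre : IsPreconnected (segment ℝ x y) := (convex_segment x y).isPreconnected
  have hcont : ContinuousOn (ramp β j : EuclideanSpace ℝ (Fin n) → ℝ) (segment ℝ x y) :=
    continuous_ramp.continuousOn
  obtain ⟨z, hz, hz0, hz1⟩ : ∃ z ∈ segment ℝ x y, ramp β j z ≠ 0 ∧ ramp β j z ≠ 1 := by
    rcases lt_or_gt_of_ne hne with h | h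
    · obtain ⟨z, hz, h1, h2⟩ := hpre.exists_mem_Ioo hcont (left_mem_segment ℝ x y)
        (right_mem_segment ℝ x y) h
      exact ⟨z, hz, ((ramp_nonneg x).trans_lt h1).ne', (h2.trans_le (ramp_le_one y)).ne⟩
    · obtain ⟨z, hz, h1, h2⟩ := hpre.exists_mem_Ioo hcont (right_mem_segment ℝ x y)
        (left_mem_segment ℝ x y) h
      exact ⟨z, hz, ((ramp_nonneg y).trans_lt h1).ne', (h2.trans_le (ramp_le_one x)).ne⟩
  have hpos : 0 < τ * d := dist_nonneg.trans_lt (Metric.mem_ball.1 hy)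
  have hzx : dist z x < τ * d :=
    (convex_ball x (τ * d)).segment_subset (Metric.mem_ball_self hpos) hy hz
  have hzG : z ∈ treeSet i₀ β ρ := ball_infDist_frontier_subset hx (by
    rw [Metric.mem_ball, ← hd]
    exact hzx.trans_le (mul_le_of_le_one_left hd0 hτ.2.le))
  obtain ⟨c, hc, σ, hzc⟩ := P.exists_of_ramp_ne_zero hz0
  have hfar : ∀ e ∈ nodes n β (j + 1), β ^ (j + 1) + margin β * β ^ j < dist z.ofLp e := by
    intro e he
    by_contra! h
    exact hz1 (P.ramp_eq_one he h)
  have hdz := P.infDist_frontier_le hi hzG hc hzc (hfar _ (child_mem_nodes hc σ))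
  have hdx : d ≤ ρ j / (1 - τ) := by
    have h1 : d ≤ Metric.infDist z (frontier (treeSet i₀ β ρ)) + dist x z :=
      Metric.infDist_le_infDist_add_dist
    rw [dist_comm] at h1
    rw [le_div_iff₀ hτ1]
    linarith
  have hdist : dist z.ofLp x.ofLp < margin β * β ^ j := by
    have h2 : ρ j / (1 - τ) ≤ margin β * β ^ j := by rwa [div_le_iff₀ hτ1]
    have h3 : τ * d ≤ d := mul_le_of_le_one_left hd0 hτ.2.le
    linarith [dist_ofLp_le z x]
  have hfar' : ∀ e ∈ nodes n β (j + 1), x.ofLp ∉ Metric.closedBall e (β ^ (j + 1)) := by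
    intro e he hxe
    rw [Metric.mem_closedBall] at hxe
    linarith [hfar e he, dist_triangle z.ofLp x.ofLp e]
  refine ⟨hdx, fun h => ?_, c, hc, σ, ?_⟩
  · obtain ⟨e, he, hxe⟩ := mem_iUnion₂.1 h
    exact hfar' e he hxe
  · have hxc : x.ofLp ∈ bigCube β c j σ := by
      rw [bigCube, Metric.mem_closedBall]
      have := dist_triangle x.ofLp z.ofLp (child β c j σ)
      rw [dist_comm x.ofLp z.ofLp] at this
      linarith
    exact (inTree_or_mem_tube P hi hc hx hxc).resolve_left fun h =>
      hfar' _ (child_mem_nodes hc σ) (h.mem_closedBall P)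

/-- Two different cut-off functions do not vary near the same point. -/
theorem TreeParams.ramp_ne_unique (P : TreeParams β ρ) {i₁ : Fin n} (hi : i₁ ≠ i₀)
    (hτ : τ ∈ Ioo (0 : ℝ) 1) (hρ : ∀ j, ρ j ≤ margin β * β ^ j * (1 - τ))
    {x y y' : EuclideanSpace ℝ (Fin n)} (hx : x ∈ treeSet i₀ β ρ)
    (hy : y ∈ Metric.ball x (τ * Metric.infDist x (frontier (treeSet i₀ β ρ))))
    (hy' : y' ∈ Metric.ball x (τ * Metric.infDist x (frontier (treeSet i₀ β ρ)))) {j j' : ℕ}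
    (hne : ramp β j x ≠ ramp β j y) (hne' : ramp β j' x ≠ ramp β j' y') : j = j' := by
  have key : ∀ {y y' : EuclideanSpace ℝ (Fin n)} {j j' : ℕ},
      y ∈ Metric.ball x (τ * Metric.infDist x (frontier (treeSet i₀ β ρ))) →
      y' ∈ Metric.ball x (τ * Metric.infDist x (frontier (treeSet i₀ β ρ))) →
      ramp β j x ≠ ramp β j y → ramp β j' x ≠ ramp β j' y' → ¬ j < j' := by
    intro y y' j j' hy hy' hne hne' hlt
    obtain ⟨-, h1, -⟩ := P.of_ramp_ne hi hτ (hρ j) hx hy hne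
    obtain ⟨-, -, c, hc, σ, h2⟩ := P.of_ramp_ne hi hτ (hρ j') hx hy' hne'
    -- A tube of generation `j'` lies in a cube of generation `j' ≥ j + 1`, whereas variation of the
    -- ramp of generation `j` places `x` outside the cubes of generation `j + 1`.
    exact h1 (cubes_antitone P hlt (mem_iUnion₂.2 ⟨c, hc, tube_subset_closedBall P h2⟩))
  exact le_antisymm (not_lt.1 (key hy' hy hne' hne)) (not_lt.1 (key hy hy' hne hne'))

theorem TreeParams.ramp_eq_zero_of_mem_room (P : TreeParams β ρ) {x : EuclideanSpace ℝ (Fin n)}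
    (hx : x.ofLp ∈ room i₀ β 0 0) : ramp β j x = 0 := by
  by_contra h
  obtain ⟨c, hc, σ, hxc⟩ := P.exists_of_ramp_ne_zero h
  have hm := mul_pos P.margin_pos (P.pow_pos j)
  have hbig : x.ofLp ∈ bigCube β c j σ := by
    rw [bigCube, Metric.mem_closedBall]; linarith
  have key : ∀ (k : ℕ) (c : Fin n → ℝ) (σ : Fin n → Bool), c ∈ nodes n β k →
      x.ofLp ∉ bigCube β c k σ := by
    intro k
    induction k with
    | zero =>
      intro c σ hc hxb
      have : c = 0 := by simpa [nodes] using hc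
      subst this
      exact (disjoint_room_bigCube P).notMem_of_mem_left hx hxb
    | succ k ih =>
      intro c σ hc hxb
      obtain ⟨d, hd, σ', rfl⟩ := mem_nodes_succ.1 hc
      exact ih d σ' hd (closedBall_child_subset_bigCube P (bigCube_subset P hxb))
  exact key j c σ hc hbig

end Ramp

/-! ### Upper bound for the fractional energy -/

section Energy

variable {n : ℕ} {i₀ : Fin n} {β : ℝ} {ρ : ℕ → ℝ} {τ δ p : ℝ} {j : ℕ}

theorem prod_ite_eq_mul_pow (i₀ : Fin n) (a b : ℝ) :
    ∏ i, (if i = i₀ then a else b) = a * b ^ (n - 1) := by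
  rw [← Finset.mul_prod_erase _ _ (Finset.mem_univ i₀), if_pos rfl,
    Finset.prod_congr rfl (g := fun _ => b) fun j hj => if_neg (Finset.ne_of_mem_erase hj)]
  simp [Finset.card_erase_of_mem]

/-- The union of the tubes joining generation `j` to generation `j + 1`. -/
def tubes (i₀ : Fin n) (β : ℝ) (ρ : ℕ → ℝ) (j : ℕ) : Set (Fin n → ℝ) :=
  ⋃ c ∈ nodes n β j, ⋃ σ ∈ (Finset.univ : Finset (Fin n → Bool)), tube i₀ β ρ c j σ

theorem measurableSet_preimage_tubes :
    MeasurableSet (WithLp.ofLp ⁻¹' tubes i₀ β ρ j : Set (EuclideanSpace ℝ (Fin n))) :=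
  ((isOpen_biUnion fun _ _ => isOpen_biUnion fun _ _ => isOpen_axisBox _ _).preimage
    (PiLp.continuous_ofLp 2 _)).measurableSet

theorem TreeParams.volume_tubes_le (P : TreeParams β ρ) (j : ℕ) :
    volume (tubes i₀ β ρ j) ≤
      ENNReal.ofReal ((2 ^ n) ^ (j + 1) * (β ^ j * (2 * ρ j) ^ (n - 1))) := by
  have hj := P.pow_pos j
  have hρ := P.thick_pos j
  have hρ' := P.thick_lt j
  have hone : ∀ c σ, volume (tube i₀ β ρ c j σ) ≤
      ENNReal.ofReal (β ^ j * (2 * ρ j) ^ (n - 1)) := by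
    intro c σ
    rw [tube, volume_axisBox, ← ENNReal.ofReal_prod_of_nonneg]
    · refine ENNReal.ofReal_le_ofReal ?_
      have : ∀ i, 2 * tubeWidth i₀ β ρ j i =
          if i = i₀ then 2 * (β ^ j / 4 + ρ j) else 2 * ρ j := by
        intro i; unfold tubeWidth; split_ifs <;> rfl
      simp only [this]
      rw [prod_ite_eq_mul_pow]
      exact mul_le_mul_of_nonneg_right (by linarith) (by positivity)
    · intro i _
      unfold tubeWidth; split_ifs <;> positivity
  refine (measure_biUnion_finset_le _ _).trans ((Finset.sum_le_sum fun c _ =>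
    (measure_biUnion_finset_le _ _).trans (Finset.sum_le_sum fun σ _ => hone c σ)).trans
      (le_of_eq ?_))
  rw [Finset.sum_const, Finset.sum_const, card_nodes P, Finset.card_univ, nsmul_eq_mul,
    nsmul_eq_mul, ← ENNReal.ofReal_natCast, ← ENNReal.ofReal_natCast,
    ← ENNReal.ofReal_mul (by positivity), ← ENNReal.ofReal_mul (by positivity)]
  congr 1
  simp only [Fintype.card_fun, Fintype.card_bool, Fintype.card_fin]
  push_cast
  ring

theorem rpow_div_rpow_le {a b L p e : ℝ} (ha : 0 ≤ a) (hb : 0 ≤ b) (hL : 0 ≤ L) (hp : 0 < p)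
    (h : a ≤ L * b) : a ^ p / b ^ e ≤ L ^ p * b ^ (p - e) := by
  rcases hb.eq_or_lt with h0 | h0
  · have ha0 : a = 0 := le_antisymm (by rw [← h0, mul_zero] at h; exact h) ha
    rw [ha0, Real.zero_rpow hp.ne', zero_div]
    exact mul_nonneg (Real.rpow_nonneg hL _) (Real.rpow_nonneg hb _)
  · rw [Real.rpow_sub h0, ← mul_div_assoc, ← Real.mul_rpow hL hb]
    exact div_le_div_of_nonneg_right (Real.rpow_le_rpow ha h hp.le) (Real.rpow_nonneg hb _)

/-- For fixed `x` at most one summand varies on the inner ball, and then `x` lies in a tube of that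
generation and the ball has radius at most `ρ j / (1 - τ)`. The Lipschitz bound reduces the inner
integral to that of `‖x - y‖ ^ ((1 - δ) * p - n)`, which is finite because `δ < 1`. -/
theorem TreeParams.fractionalEnergy_le (P : TreeParams β ρ) {i₁ : Fin n} (hi : i₁ ≠ i₀)
    (hτ : τ ∈ Ioo (0 : ℝ) 1) (hρ : ∀ j, ρ j ≤ margin β * β ^ j * (1 - τ)) (hδ : δ < 1)
    (hp : 0 < p) {A : ℕ → ℝ} (hA : ∀ j, 0 ≤ A j) (M : ℕ) :
    fractionalEnergy δ τ p (treeSet i₀ β ρ)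
        (fun x => ∑ j ∈ Finset.range M, A j * ramp β j x) ≤
      ∑ j ∈ Finset.range M, ENNReal.ofReal ((A j / (margin β * β ^ j)) ^ p *
        (n * volume.real (Metric.ball (0 : EuclideanSpace ℝ (Fin n)) 1) / ((1 - δ) * p) *
          (ρ j / (1 - τ)) ^ ((1 - δ) * p))) * volume (tubes i₀ β ρ j) := by
  have hn : 0 < n := i₀.pos
  have hα : 0 < (1 - δ) * p := mul_pos (by linarith) hp
  have hτ1 : 0 < 1 - τ := by linarith [hτ.2]
  set G := treeSet i₀ β ρ with hG
  set u : EuclideanSpace ℝ (Fin n) → ℝ := fun x => ∑ j ∈ Finset.range M, A j * ramp β j x with hu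
  set F : ℕ → ℝ≥0∞ := fun j => ENNReal.ofReal ((A j / (margin β * β ^ j)) ^ p *
        (n * volume.real (Metric.ball (0 : EuclideanSpace ℝ (Fin n)) 1) / ((1 - δ) * p) *
          (ρ j / (1 - τ)) ^ ((1 - δ) * p))) with hF
  set T : ℕ → Set (EuclideanSpace ℝ (Fin n)) := fun j => WithLp.ofLp ⁻¹' tubes i₀ β ρ j with hT
  have hdiff : ∀ x y, u x - u y =
      ∑ j ∈ Finset.range M, A j * (ramp β j x - ramp β j y) := by
    intro x y
    simp only [hu, ← Finset.sum_sub_distrib, mul_sub]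
  have hinner : ∀ x ∈ G, ∫⁻ y in G ∩ Metric.ball x (τ * Metric.infDist x (frontier G)),
      ENNReal.ofReal (|u x - u y| ^ p / ‖x - y‖ ^ ((n : ℝ) + δ * p)) ≤
      ∑ j ∈ Finset.range M, (T j).indicator (fun _ => F j) x := by
    intro x hx
    have hmeas : MeasurableSet (G ∩ Metric.ball x (τ * Metric.infDist x (frontier G))) :=
      isOpen_treeSet.measurableSet.inter Metric.isOpen_ball.measurableSet
    by_cases hex : ∃ j ∈ Finset.range M, ∃ y ∈ Metric.ball x (τ * Metric.infDist x (frontier G)),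
        ramp β j x ≠ ramp β j y
    · obtain ⟨j, hj, y₀, hy₀, hne⟩ := hex
      obtain ⟨hd, -, c, hc, σ, hxc⟩ := P.of_ramp_ne hi hτ (hρ j) hx hy₀ hne
      have hxT : x ∈ T j := mem_iUnion₂.2 ⟨c, hc, mem_iUnion₂.2 ⟨σ, Finset.mem_univ σ, hxc⟩⟩
      refine le_trans ?_ (Finset.single_le_sum (f := fun j => (T j).indicator (fun _ => F j) x)
        (fun _ _ => zero_le) hj)
      simp only [indicator_of_mem hxT]
      have hm := mul_pos P.margin_pos (P.pow_pos j)
      set L := A j / (margin β * β ^ j) with hL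
      have hL0 : 0 ≤ L := div_nonneg (hA j) hm.le
      have hR0 : 0 < ρ j / (1 - τ) := div_pos (P.thick_pos j) hτ1
      have hbound : ∀ y ∈ G ∩ Metric.ball x (τ * Metric.infDist x (frontier G)),
          ENNReal.ofReal (|u x - u y| ^ p / ‖x - y‖ ^ ((n : ℝ) + δ * p)) ≤
          ENNReal.ofReal (L ^ p) * ENNReal.ofReal (‖x - y‖ ^ ((1 - δ) * p - n)) := by
        intro y hy
        have huy : u x - u y = A j * (ramp β j x - ramp β j y) := by
          rw [hdiff]
          refine Finset.sum_eq_single_of_mem j hj fun j' _ hjj' => ?_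
          by_cases h : ramp β j' x = ramp β j' y
          · rw [h, sub_self, mul_zero]
          · exact absurd (P.ramp_ne_unique hi hτ hρ hx hy.2 hy₀ h hne) hjj'
        rw [← ENNReal.ofReal_mul (Real.rpow_nonneg hL0 _)]
        refine ENNReal.ofReal_le_ofReal ?_
        have hle : |u x - u y| ≤ L * ‖x - y‖ := by
          rw [huy, abs_mul, abs_of_nonneg (hA j), hL, div_mul_eq_mul_div, mul_div_assoc]
          exact mul_le_mul_of_nonneg_left (P.abs_ramp_sub_le x y) (hA j)
        have := rpow_div_rpow_le (e := (n : ℝ) + δ * p) (abs_nonneg _) (norm_nonneg _) hL0 hp hle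
        have he : p - ((n : ℝ) + δ * p) = (1 - δ) * p - n := by ring
        rwa [he] at this
      have hsub : G ∩ Metric.ball x (τ * Metric.infDist x (frontier G)) ⊆
          Metric.ball x (ρ j / (1 - τ)) :=
        inter_subset_right.trans (Metric.ball_subset_ball
          ((mul_le_of_le_one_left Metric.infDist_nonneg hτ.2.le).trans hd))
      calc _ ≤ ∫⁻ y in G ∩ Metric.ball x (τ * Metric.infDist x (frontier G)),
            ENNReal.ofReal (L ^ p) * ENNReal.ofReal (‖x - y‖ ^ ((1 - δ) * p - n)) :=
            setLIntegral_mono' hmeas hbound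
        _ ≤ ∫⁻ y in Metric.ball x (ρ j / (1 - τ)),
            ENNReal.ofReal (L ^ p) * ENNReal.ofReal (‖x - y‖ ^ ((1 - δ) * p - n)) :=
            lintegral_mono_set hsub
        _ = F j := by
            rw [lintegral_const_mul' _ _ ENNReal.ofReal_ne_top,
              lintegral_ball_norm_sub_rpow hn hα hR0,
              ← ENNReal.ofReal_mul (Real.rpow_nonneg hL0 _)]
    · push Not at hex
      rw [setLIntegral_congr_fun hmeas (g := fun _ => 0)]
      · simp
      · intro y hy
        have huy : u x - u y = 0 := by
          rw [hdiff]
          exact Finset.sum_eq_zero fun j hj => by rw [hex j hj y hy.2, sub_self, mul_zero]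
        simp [huy, Real.zero_rpow hp.ne']
  unfold fractionalEnergy
  calc _ ≤ ∫⁻ x in G, ∑ j ∈ Finset.range M, (T j).indicator (fun _ => F j) x :=
        setLIntegral_mono' isOpen_treeSet.measurableSet hinner
    _ ≤ ∫⁻ x, ∑ j ∈ Finset.range M, (T j).indicator (fun _ => F j) x := setLIntegral_le_lintegral _ _
    _ = ∑ j ∈ Finset.range M, ∫⁻ x, (T j).indicator (fun _ => F j) x :=
        lintegral_finsetSum _ fun j _ => measurable_const.indicator measurableSet_preimage_tubes
    _ = _ := by
        refine Finset.sum_congr rfl fun j _ => ?_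
        rw [lintegral_indicator_const measurableSet_preimage_tubes, volume_preimage_ofLp]

/-- The union of the rooms of generation `k`. -/
def rooms (i₀ : Fin n) (β : ℝ) (k : ℕ) : Set (Fin n → ℝ) := ⋃ c ∈ nodes n β k, room i₀ β c k

theorem isOpen_rooms (k : ℕ) : IsOpen (rooms i₀ β k) :=
  isOpen_biUnion fun _ _ => isOpen_axisBox _ _

theorem TreeParams.volume_room (P : TreeParams β ρ) (c : Fin n → ℝ) (k : ℕ) :
    volume (room i₀ β c k) = ENNReal.ofReal ((β ^ n) ^ k * (2 * margin β * (3 / 2) ^ (n - 1))) := by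
  have hn : 0 < n := i₀.pos
  have hk := P.pow_pos k
  have hm := P.margin_pos
  rw [room, volume_axisBox, ← ENNReal.ofReal_prod_of_nonneg]
  · have : ∀ i, 2 * roomWidth i₀ β k i =
        if i = i₀ then 2 * (margin β * β ^ k) else 3 / 2 * β ^ k := by
      intro i; unfold roomWidth; split_ifs <;> ring
    simp only [this]
    rw [prod_ite_eq_mul_pow, mul_pow, pow_right_comm β n k, ← mul_pow_sub_one hn.ne' (β ^ k)]
    congr 1
    ring
  · intro i _
    unfold roomWidth; split_ifs <;> positivity

theorem TreeParams.volume_rooms (P : TreeParams β ρ) (k : ℕ) :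
    volume (rooms i₀ β k) =
      ENNReal.ofReal ((2 ^ n * β ^ n) ^ k * (2 * margin β * (3 / 2) ^ (n - 1))) := by
  rw [rooms, measure_biUnion_finset (fun a ha b hb hab => (pairwiseDisjoint_nodes P k ha hb
    hab).mono (room_subset_closedBall P) (room_subset_closedBall P))
    fun _ _ => (isOpen_axisBox _ _).measurableSet]
  simp only [P.volume_room]
  rw [Finset.sum_const, card_nodes P, nsmul_eq_mul, ← ENNReal.ofReal_natCast,
    ← ENNReal.ofReal_mul (by positivity)]
  congr 1
  push_cast
  rw [mul_pow]
  ring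

end Energy

/-! ### Failure of the Poincaré inequality -/

section Failure

variable {n : ℕ} {i₀ : Fin n} {β : ℝ} {ρ : ℕ → ℝ} {τ δ p : ℝ}

/-- The test function on which the Poincaré inequality fails. -/
noncomputable def towerFun (β : ℝ) (M : ℕ) (x : EuclideanSpace ℝ (Fin n)) : ℝ :=
  ∑ j ∈ Finset.range M, ((2 ^ n * β ^ n) ^ j)⁻¹ * ramp β j x

theorem continuous_towerFun (M : ℕ) :
    Continuous (towerFun β M : EuclideanSpace ℝ (Fin n) → ℝ) :=
  continuous_finsetSum _ fun _ _ => continuous_const.mul continuous_ramp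

theorem TreeParams.volume_treeSet_lt_top (P : TreeParams β ρ) :
    volume (treeSet i₀ β ρ) < ⊤ := (isBounded_treeSet P).measure_lt_top

theorem TreeParams.memLp_towerFun (P : TreeParams β ρ) (M : ℕ) (q : ℝ≥0∞) :
    MemLp (towerFun β M) q (volume.restrict (treeSet i₀ β ρ)) := by
  have : IsFiniteMeasure (volume.restrict (treeSet i₀ β ρ)) :=
    isFiniteMeasure_restrict.2 P.volume_treeSet_lt_top.ne
  refine MemLp.of_bound (continuous_towerFun M).aestronglyMeasurable
    (∑ j ∈ Finset.range M, ((2 ^ n * β ^ n) ^ j)⁻¹ * 1) (Eventually.of_forall fun x => ?_)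
  have hβ := P.pos
  rw [towerFun, Real.norm_of_nonneg
    (Finset.sum_nonneg fun j _ => mul_nonneg (by positivity) (ramp_nonneg x))]
  exact Finset.sum_le_sum fun j _ => mul_le_mul_of_nonneg_left (ramp_le_one x) (by positivity)

theorem TreeParams.integrableOn_ramp (P : TreeParams β ρ) (j : ℕ) :
    IntegrableOn (ramp β j) (treeSet i₀ β ρ) := by
  have : IsFiniteMeasure (volume.restrict (treeSet i₀ β ρ)) :=
    isFiniteMeasure_restrict.2 P.volume_treeSet_lt_top.ne
  refine Integrable.of_bound continuous_ramp.aestronglyMeasurable 1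
    (Eventually.of_forall fun x => ?_)
  rw [Real.norm_of_nonneg (ramp_nonneg x)]
  exact ramp_le_one x

theorem TreeParams.le_integral_ramp (P : TreeParams β ρ) (j : ℕ) :
    (2 ^ n * β ^ n) ^ (j + 1) * (2 * margin β * (3 / 2) ^ (n - 1)) ≤
      ∫ x in treeSet i₀ β ρ, ramp β j x := by
  have hβ := P.pos
  have hm := P.margin_pos
  set R : Set (EuclideanSpace ℝ (Fin n)) := WithLp.ofLp ⁻¹' rooms i₀ β (j + 1) with hR
  have hRG : R ⊆ treeSet i₀ β ρ := fun x hx => by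
    obtain ⟨c, hc, h⟩ := mem_iUnion₂.1 hx
    exact room_subset_treeDomain hc h
  have hRm : MeasurableSet R :=
    ((isOpen_rooms (j + 1)).preimage (PiLp.continuous_ofLp 2 _)).measurableSet
  have h1 : ∫ x in R, ramp β j x = volume.real R := by
    rw [setIntegral_congr_fun hRm (g := fun _ => 1)]
    · simp
    · intro x hx
      obtain ⟨c, hc, h⟩ := mem_iUnion₂.1 hx
      have := Metric.mem_closedBall.1 (room_subset_closedBall P h)
      have hm' := mul_pos hm (P.pow_pos j)
      exact P.ramp_eq_one hc (by linarith)
  have h2 : volume.real R = (2 ^ n * β ^ n) ^ (j + 1) * (2 * margin β * (3 / 2) ^ (n - 1)) := by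
    rw [measureReal_def, hR, volume_preimage_ofLp, P.volume_rooms,
      ENNReal.toReal_ofReal (by positivity)]
  rw [← h2, ← h1]
  exact setIntegral_mono_set (P.integrableOn_ramp j)
    (Eventually.of_forall fun x => ramp_nonneg x) (Eventually.of_forall hRG)

/-- The weights of `towerFun` cancel the volume of the rooms of generation `j + 1`, on which `ramp β
j` equals one, so every summand contributes the same amount. -/
theorem TreeParams.le_integral_towerFun (P : TreeParams β ρ) (M : ℕ) :
    M * (2 ^ n * β ^ n * (2 * margin β * (3 / 2) ^ (n - 1))) ≤
      ∫ x in treeSet i₀ β ρ, towerFun β M x := by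
  have hβ := P.pos
  unfold towerFun
  rw [integral_finsetSum _ fun j _ => (P.integrableOn_ramp j).const_mul _]
  have : ∀ j ∈ Finset.range M, 2 ^ n * β ^ n * (2 * margin β * (3 / 2) ^ (n - 1)) ≤
      ∫ x in treeSet i₀ β ρ, ((2 ^ n * β ^ n) ^ j)⁻¹ * ramp β j x := by
    intro j _
    rw [integral_const_mul]
    have hq : 0 < (2 ^ n * β ^ n) ^ j := by positivity
    have := mul_le_mul_of_nonneg_left (P.le_integral_ramp (i₀ := i₀) j) (inv_nonneg.2 hq.le)
    rwa [pow_succ, mul_assoc ((2 ^ n * β ^ n) ^ j), inv_mul_cancel_left₀ hq.ne'] at this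
  simpa using Finset.sum_le_sum this

/-- The function vanishes on the root room, a fixed set of positive volume, while its mean grows at
least linearly in `M`. -/
theorem TreeParams.le_lintegral_towerFun (P : TreeParams β ρ) :
    ∃ κ : ℝ, 0 < κ ∧ ∀ M : ℕ, ENNReal.ofReal (κ * M) ≤ ∫⁻ x in treeSet i₀ β ρ,
      ENNReal.ofReal (|towerFun β M x - ⨍ y in treeSet i₀ β ρ, towerFun β M y| ^ (1 : ℝ)) := by
  have hβ := P.pos
  have hm := P.margin_pos
  set G := treeSet i₀ β ρ with hG
  set Z : Set (EuclideanSpace ℝ (Fin n)) := WithLp.ofLp ⁻¹' room i₀ β 0 0 with hZ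
  have hZG : Z ⊆ G := fun x hx => room_subset_treeDomain (by simp [nodes]) hx
  have hZm : MeasurableSet Z :=
    ((isOpen_axisBox _ _).preimage (PiLp.continuous_ofLp 2 _)).measurableSet
  set v : ℝ := (β ^ n) ^ 0 * (2 * margin β * (3 / 2) ^ (n - 1)) with hv
  have hv0 : 0 < v := by positivity
  have hvol : volume Z = ENNReal.ofReal v := by rw [hZ, volume_preimage_ofLp, P.volume_room]
  have hGv : 0 < volume.real G := by
    refine ENNReal.toReal_pos (ne_of_gt (lt_of_lt_of_le ?_ (measure_mono hZG)))
      P.volume_treeSet_lt_top.ne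
    rw [hvol]; exact ENNReal.ofReal_pos.2 hv0
  set q : ℝ := 2 ^ n * β ^ n * (2 * margin β * (3 / 2) ^ (n - 1)) with hq
  have hq0 : 0 < q := by positivity
  refine ⟨(volume.real G)⁻¹ * q * v, by positivity, fun M => ?_⟩
  set m : ℝ := ⨍ y in G, towerFun β M y with hm'
  have hmle : (volume.real G)⁻¹ * (M * q) ≤ m := by
    rw [hm', setAverage_eq, smul_eq_mul]
    exact mul_le_mul_of_nonneg_left (P.le_integral_towerFun M) (by positivity)
  have hzero : ∀ x ∈ Z, towerFun β M x = 0 := fun x hx =>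
    Finset.sum_eq_zero fun j _ => by rw [P.ramp_eq_zero_of_mem_room hx, mul_zero]
  calc ENNReal.ofReal ((volume.real G)⁻¹ * q * v * M) ≤ ENNReal.ofReal |m| * volume Z := by
        rw [hvol, ← ENNReal.ofReal_mul (abs_nonneg m)]
        refine ENNReal.ofReal_le_ofReal ?_
        have := mul_le_mul_of_nonneg_right (hmle.trans (le_abs_self m)) hv0.le
        linarith
    _ = ∫⁻ x in Z, ENNReal.ofReal |m| := by rw [setLIntegral_const]
    _ = ∫⁻ x in Z, ENNReal.ofReal (|towerFun β M x - m| ^ (1 : ℝ)) := by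
        refine setLIntegral_congr_fun hZm fun x hx => ?_
        simp [hzero x hx]
    _ ≤ _ := lintegral_mono_set hZG

theorem exists_nat_mul_rpow_lt {κ D p : ℝ} (hκ : 0 < κ) (hp : 1 < p) :
    ∃ M : ℕ, D * (M : ℝ) ^ (1 / p) < κ * M := by
  have hp0 : 0 < p := by linarith
  have he : 0 < 1 - 1 / p := by rw [sub_pos, div_lt_one hp0]; exact hp
  have h := ((tendsto_rpow_atTop he).comp tendsto_natCast_atTop_atTop).eventually_gt_atTop (D / κ)
  obtain ⟨M, hM, hM1⟩ := (h.and (eventually_ge_atTop 1)).exists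
  refine ⟨M, ?_⟩
  have hM0 : (0 : ℝ) < M := by exact_mod_cast hM1
  have hM' : D / κ < (M : ℝ) ^ (1 - 1 / p) := hM
  rw [Real.rpow_sub hM0, Real.rpow_one, lt_div_iff₀ (Real.rpow_pos_of_pos hM0 _),
    div_mul_eq_mul_div, div_lt_iff₀ hκ] at hM'
  linarith

theorem TreeParams.not_supportsFractionalPoincare (P : TreeParams β ρ) {i₁ : Fin n} (hi : i₁ ≠ i₀)
    (hτ : τ ∈ Ioo (0 : ℝ) 1) (hρ : ∀ j, ρ j ≤ margin β * β ^ j * (1 - τ)) (hδ : δ < 1)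
    (hp : 1 < p) {C : ℝ} (hC : ∀ j : ℕ,
      (((2 ^ n * β ^ n) ^ j)⁻¹ / (margin β * β ^ j)) ^ p *
        (n * volume.real (Metric.ball (0 : EuclideanSpace ℝ (Fin n)) 1) / ((1 - δ) * p) *
          (ρ j / (1 - τ)) ^ ((1 - δ) * p)) *
        ((2 ^ n) ^ (j + 1) * (β ^ j * (2 * ρ j) ^ (n - 1))) ≤ C) :
    ¬ SupportsFractionalPoincare δ τ 1 p (treeSet i₀ β ρ) := by
  rintro ⟨c, hc⟩
  have hβ := P.pos
  have hp0 : 0 < p := by linarith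
  have hτ1 : 0 < 1 - τ := by linarith [hτ.2]
  have hδ1 : 0 < 1 - δ := by linarith
  have hm := P.margin_pos
  obtain ⟨κ, hκ, hlow⟩ := P.le_lintegral_towerFun (i₀ := i₀)
  have hterm0 : ∀ j : ℕ, 0 ≤ (((2 ^ n * β ^ n) ^ j)⁻¹ / (margin β * β ^ j)) ^ p *
        (n * volume.real (Metric.ball (0 : EuclideanSpace ℝ (Fin n)) 1) / ((1 - δ) * p) *
          (ρ j / (1 - τ)) ^ ((1 - δ) * p)) := by
    intro j
    have := P.thick_pos j
    positivity
  have hC0 : 0 ≤ C := by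
    refine le_trans (mul_nonneg (hterm0 0) ?_) (hC 0)
    have := P.thick_pos 0
    positivity
  have henergy : ∀ M : ℕ, fractionalEnergy δ τ p (treeSet i₀ β ρ) (towerFun β M) ≤
      ENNReal.ofReal (C * M) := by
    intro M
    refine (P.fractionalEnergy_le hi hτ hρ hδ hp0
      (A := fun j => ((2 ^ n * β ^ n) ^ j)⁻¹) (fun j => by positivity) M).trans ?_
    calc _ ≤ ∑ j ∈ Finset.range M, ENNReal.ofReal C := by
          refine Finset.sum_le_sum fun j _ => ?_
          refine (mul_le_mul_right (P.volume_tubes_le j) _).trans ?_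
          rw [← ENNReal.ofReal_mul (hterm0 j)]
          exact ENNReal.ofReal_le_ofReal (hC j)
      _ = ENNReal.ofReal (C * M) := by
          rw [Finset.sum_const, Finset.card_range, nsmul_eq_mul, ENNReal.ofReal_mul hC0,
            ENNReal.ofReal_natCast, mul_comm]
  obtain ⟨M, hM⟩ := exists_nat_mul_rpow_lt (D := c * C ^ (1 / p)) hκ hp
  have h1 := (hlow M).trans (hc (towerFun β M) (P.memLp_towerFun M _))
  have h2 : fractionalEnergy δ τ p (treeSet i₀ β ρ) (towerFun β M) ^ (1 / p) ≤
      ENNReal.ofReal (C ^ (1 / p) * (M : ℝ) ^ (1 / p)) := by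
    refine (ENNReal.rpow_le_rpow (henergy M) (by positivity)).trans (le_of_eq ?_)
    rw [ENNReal.ofReal_rpow_of_nonneg (by positivity) (by positivity),
      Real.mul_rpow hC0 (Nat.cast_nonneg M)]
  have h3 := h1.trans (mul_le_mul_right h2 _)
  rw [← ENNReal.ofReal_coe_nnreal, ← ENNReal.ofReal_mul c.coe_nonneg,
    ENNReal.ofReal_le_ofReal_iff (by positivity)] at h3
  linarith

/-- With `b = β ^ j` this is the energy of one generation up to constants: slope, kernel integral,
and number times volume of the tubes. The total exponent of `b` is nonnegative exactly under `h`. -/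
theorem rpow_combination_le_one {b s p δ lam : ℝ} {n : ℕ} (hb : 0 < b) (hb1 : b ≤ 1) (hn : 1 ≤ n)
    (h : p * ((n : ℝ) - s * (1 - δ) - lam + 1) ≤ s * ((n : ℝ) - 1) - lam + 1) :
    (b ^ (-((n : ℝ) - lam) - 1)) ^ p * (b ^ s) ^ ((1 - δ) * p) *
      (b ^ (-lam) * (b * (b ^ s) ^ (n - 1))) ≤ 1 := by
  have h1 : b * (b ^ s) ^ (n - 1) = b ^ (1 + s * ((n : ℝ) - 1)) := by
    rw [← Real.rpow_natCast, Nat.cast_sub hn, ← Real.rpow_mul hb.le, Real.rpow_add hb,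
      Real.rpow_one, Nat.cast_one]
  rw [h1, ← Real.rpow_mul hb.le, ← Real.rpow_mul hb.le, ← Real.rpow_add hb, ← Real.rpow_add hb,
    ← Real.rpow_add hb]
  exact Real.rpow_le_one hb.le hb1 (by linarith)

end Failure

/-! ### Choice of the parameters -/

theorem theorem6p4 (n : ℕ) (hn : 2 ≤ n) (s p lam δ τ : ℝ)
    (hs : 1 < s) (hp : 1 < p) (hlam : lam ∈ Ico ((n : ℝ) - 1) (n : ℝ))
    (hδ : δ ∈ Ioo (0 : ℝ) 1) (hτ : τ ∈ Ioo (0 : ℝ) 1)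
    (hs_lt : s < ((n : ℝ) + 1 - lam) / (1 - δ))
    (hp_le : p ≤ (s * ((n : ℝ) - 1) - lam + 1) / ((n : ℝ) - s * (1 - δ) - lam + 1)) :
    ∃ G : Set (EuclideanSpace ℝ (Fin n)),
      IsJohnDomain s G ∧
      upperMinkowskiDim (frontier G) = ENNReal.ofReal lam ∧
      ¬ SupportsFractionalPoincare δ τ 1 p G := by
  have hn2 : (2 : ℝ) ≤ n := by exact_mod_cast hn
  have hlam0 : 0 < lam := by linarith [hlam.1]
  have hδ1 : 0 < 1 - δ := by linarith [hδ.2]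
  have hτ1 : 0 < 1 - τ := by linarith [hτ.2]
  rw [lt_div_iff₀ hδ1] at hs_lt
  -- The upper bound on `s` is precisely the positivity of this denominator.
  rw [le_div_iff₀ (by linarith)] at hp_le
  obtain ⟨i₀, i₁, hi⟩ : ∃ i₀ i₁ : Fin n, i₁ ≠ i₀ :=
    ⟨⟨0, by omega⟩, ⟨1, by omega⟩, by simp⟩
  set β : ℝ := 2 ^ (-((n : ℝ) / lam)) with hβdef
  have hβ0 : 0 < β := Real.rpow_pos_of_pos two_pos _
  have hβ2 : β < 1 / 2 := by
    have h1 : (1 : ℝ) / 2 = 2 ^ (-1 : ℝ) := by rw [Real.rpow_neg_one, one_div]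
    rw [h1]
    refine Real.rpow_lt_rpow_of_exponent_lt one_lt_two (neg_lt_neg ?_)
    rw [one_lt_div hlam0]
    exact hlam.2
  have hβlam : (2 : ℝ) ^ n = β ^ (-lam) := by
    rw [hβdef, ← Real.rpow_mul zero_le_two, ← Real.rpow_natCast]
    congr 1
    field_simp
  have hm : 0 < margin β := by unfold margin; linarith
  -- The factor `β` provides the exponent `k + 1` of `thick_le`; the factor `1 - τ` provides the
  -- thinness required by `TreeParams.of_ramp_ne`.
  set c₀ : ℝ := margin β * β * (1 - τ) with hc₀
  have hc₀0 : 0 < c₀ := by positivity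
  set ρ : ℕ → ℝ := fun k => c₀ * (β ^ k) ^ s with hρdef
  have hpow : ∀ k : ℕ, 0 < β ^ k ∧ β ^ k ≤ 1 ∧ (β ^ k) ^ s ≤ β ^ k := by
    intro k
    have h1 : β ^ k ≤ 1 := pow_le_one₀ hβ0.le (by linarith)
    refine ⟨by positivity, h1, ?_⟩
    simpa using Real.rpow_le_rpow_of_exponent_ge (by positivity : 0 < β ^ k) h1 hs.le
  have hρle : ∀ k, ρ k ≤ margin β * β ^ (k + 1) * (1 - τ) := by
    intro k
    calc ρ k ≤ c₀ * β ^ k := mul_le_mul_of_nonneg_left (hpow k).2.2 hc₀0.le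
      _ = margin β * β ^ (k + 1) * (1 - τ) := by rw [hc₀, pow_succ]; ring
  have P : TreeParams β ρ := by
    refine ⟨hβ0, hβ2, fun k => ?_, fun k => (hρle k).trans ?_⟩
    · have := (hpow k).1
      positivity
    · exact mul_le_of_le_one_right (by positivity) (by linarith [hτ.1])
  have hρ' : ∀ j, ρ j ≤ margin β * β ^ j * (1 - τ) := fun j => (hρle j).trans <| by
    refine mul_le_mul_of_nonneg_right (mul_le_mul_of_nonneg_left ?_ hm.le) hτ1.le
    exact pow_le_pow_of_le_one hβ0.le (by linarith) j.le_succ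
  refine ⟨treeSet i₀ β ρ, ?_, P.upperMinkowskiDim_frontier hi hβlam hlam.1, ?_⟩
  · have h4 : 0 < (4 * (n : ℝ)) ^ s := Real.rpow_pos_of_pos (by linarith) _
    refine P.isJohnDomain (a := c₀ / (4 * n) ^ s) (by positivity) hs.le fun k => le_of_eq ?_
    rw [Real.mul_rpow (by linarith) (hpow k).1.le, ← mul_assoc, div_mul_cancel₀ _ h4.ne']
  · set V : ℝ := volume.real (Metric.ball (0 : EuclideanSpace ℝ (Fin n)) 1)
    set α : ℝ := (1 - δ) * p with hα
    have hV : 0 ≤ V := measureReal_nonneg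
    have hα0 : 0 < α := mul_pos hδ1 (by linarith)
    refine P.not_supportsFractionalPoincare hi hτ hρ' hδ.2 hp
      (C := (margin β)⁻¹ ^ p * (n * V / α * (c₀ / (1 - τ)) ^ α) *
        (2 ^ n * (2 * c₀) ^ (n - 1))) fun j => ?_
    obtain ⟨hb, hb1, -⟩ := hpow j
    have hbs : 0 < (β ^ j) ^ s := Real.rpow_pos_of_pos hb _
    have hcomb := rpow_combination_le_one (δ := δ) hb hb1 (by omega : 1 ≤ n) hp_le
    have hpowj : ∀ e : ℝ, (β ^ e) ^ j = (β ^ j) ^ e := by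
      intro e
      rw [← Real.rpow_natCast (β ^ e), ← Real.rpow_mul hβ0.le, mul_comm e, Real.rpow_mul hβ0.le,
        Real.rpow_natCast]
    have e1 : (((2 ^ n * β ^ n) ^ j)⁻¹ / (margin β * β ^ j)) ^ p =
        (margin β)⁻¹ ^ p * ((β ^ j) ^ (-((n : ℝ) - lam) - 1)) ^ p := by
      rw [← Real.mul_rpow (by positivity) (by positivity), P.two_pow_mul hβlam, hpowj,
        Real.rpow_sub_one hb.ne', Real.rpow_neg hb.le]
      congr 1
      field_simp
    have e2 : (ρ j / (1 - τ)) ^ α = (c₀ / (1 - τ)) ^ α * ((β ^ j) ^ s) ^ α := by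
      rw [← Real.mul_rpow (by positivity) hbs.le]
      congr 1
      simp only [hρdef]
      ring
    have e3 : ((2 : ℝ) ^ n) ^ (j + 1) = 2 ^ n * (β ^ j) ^ (-lam) := by
      rw [pow_succ, mul_comm, ← hpowj, ← hβlam]
    have e4 : (2 * ρ j) ^ (n - 1) = (2 * c₀) ^ (n - 1) * ((β ^ j) ^ s) ^ (n - 1) := by
      rw [← mul_pow]
      simp only [hρdef]
      ring
    rw [e1, e2, e3, e4]
    refine le_trans (le_of_eq ?_) (mul_le_of_le_one_right (a := (margin β)⁻¹ ^ p *
      (n * V / α * (c₀ / (1 - τ)) ^ α) * (2 ^ n * (2 * c₀) ^ (n - 1))) (by positivity) hcomb)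
    rw [← hα]
    ring
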